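/- Let $\alpha=(\alpha_1\ge\alpha_2\ge\cdots\ge\alpha_\ell)$ be a partition of $|\alpha|=\alpha_1+\cdots+\alpha_\ell$ with all parts $\alpha_i\ge 2$. A ribbon is a skew shape, not necessarily connected, that contains no $2\times 2$ block of boxes. Let $R_\alpha$ be a ribbon whose row lengths from top to bottom are $\alpha_1,\dots,\alpha_\ell$. Its overlapping partition is $p=(p_1,\dots,p_{\ell-1},0)$, where $p_i$ is the number of columns with two boxes in the part of $R_\alpha$ formed by its last $\ell-i+1$ rows; $\alpha$ and $p$ determine the ribbon up to empty rows and columns, and it is denoted $R_\alpha^p$. The Schur support $[R_\alpha^p]$ is the set of partitions $\nu$ such that the Schur function $s_\nu$ occurs with a positive coefficient in the expansion of the skew Schur function $s_{R_\alpha^p}$ in Schur functions. For partitions $\lambda,\mu$ of the same number, $[\lambda,\mu]$ denotes the set of all partitions $\nu$ with $\lambda\preceq\nu\preceq\mu$ in the dominance order. (a) If $p=(2,1,0,\dots,0)$ (so $\ell\ge 3$), then $$[R_\alpha^p]=[\alpha,(|\alpha|-2,2)]\quad\Longleftrightarrow\quad \alpha_1<\sum_{q=2}^{\ell}\alpha_q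 .$$ (b) If $p=(3,2,1,0,\dots,0)$ (so $\ell\ge 4$), then $$[R_\alpha^p]=[\alpha,(|\alpha|-3,3)]\quad\Longleftrightarrow\quad \alpha_1<\sum_{q=2}^{\ell}\alpha_q-2\ \text{ and }\ \alpha_2<\sum_{q=3}^{\ell}\alpha_q .$$ -/

import Mathlib

/-! Partitions are Mathlib's `YoungDiagram`s, drawn in English notation: the box `(i, j)` lies in row
`i` (counted from the top) and column `j` (counted from the left), and both are counted from `0`. -/

/-- A skew shape `outer / inner`. -/
structure SkewShape where
  outer : YoungDiagram
  inner : YoungDiagram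
  inner_le : inner ≤ outer

namespace SkewShape

/-- The boxes of the skew shape. -/
def cells (A : SkewShape) : Finset (ℕ × ℕ) := A.outer.cells \ A.inner.cells

/-- The number of boxes in row `i`. -/
def rowLength (A : SkewShape) (i : ℕ) : ℕ := (A.cells.filter fun c => c.1 = i).card

/-- A ribbon, connected or not: a skew shape that contains no `2 × 2` block of boxes. -/
def IsRibbon (A : SkewShape) : Prop :=
  ∀ i j : ℕ, ¬ ((i, j) ∈ A.cells ∧ (i, j + 1) ∈ A.cells ∧
    (i + 1, j) ∈ A.cells ∧ (i + 1, j + 1) ∈ A.cells)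

/-- The number of columns with exactly two boxes in the part of `A` formed by the rows `i, i + 1, …`.
If the rows of the ribbon `A` have weakly decreasing lengths `≥ 2`, the sequence
`A.overlap 0, A.overlap 1, …` is the overlapping partition of `A`. -/
def overlap (A : SkewShape) (i : ℕ) : ℕ :=
  ((A.cells.image Prod.snd).filter fun j =>
    (A.cells.filter fun c => i ≤ c.1 ∧ c.2 = j).card = 2).card

end SkewShape

/-- Semistandard tableaux of skew shape `A`: the entries increase weakly along rows and strictly
down columns. (As in Mathlib's `SemistandardYoungTableau`, entries are natural numbers, and the entry
at a position outside the shape is `0` by convention.) -/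
structure SkewTableau (A : SkewShape) where
  entry : ℕ → ℕ → ℕ
  row_weak : ∀ {i j₁ j₂ : ℕ}, j₁ < j₂ → (i, j₁) ∈ A.cells → (i, j₂) ∈ A.cells →
    entry i j₁ ≤ entry i j₂
  col_strict : ∀ {i₁ i₂ j : ℕ}, i₁ < i₂ → (i₁, j) ∈ A.cells → (i₂, j) ∈ A.cells →
    entry i₁ j < entry i₂ j
  zeros : ∀ {i j : ℕ}, (i, j) ∉ A.cells → entry i j = 0

/-- The content of a filling `T` of a finite set of boxes: `k` is sent to the number of entries `k`.
It is the exponent of the monomial `x^T`. -/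
noncomputable def fillingContent (cells : Finset (ℕ × ℕ)) (T : ℕ → ℕ → ℕ) : ℕ →₀ ℕ :=
  ∑ c ∈ cells, Finsupp.single (T c.1 c.2) 1

/-- The Schur function `s_ν = ∑ x^T` over the semistandard tableaux `T` of shape `ν`, a formal power
series in the variables `x₀, x₁, …`: the coefficient of `x^t` is the number of tableaux of content `t`. -/
noncomputable def schurFunction (ν : YoungDiagram) : MvPowerSeries ℕ ℚ :=
  fun t => (Nat.card {T : SemistandardYoungTableau ν // fillingContent ν.cells T = t} : ℚ)

/-- The skew Schur function `s_A = ∑ x^T` over the semistandard tableaux `T` of skew shape `A`. -/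
noncomputable def skewSchurFunction (A : SkewShape) : MvPowerSeries ℕ ℚ :=
  fun t => (Nat.card {T : SkewTableau A // fillingContent A.cells T.entry = t} : ℚ)

/-- The Schur support `[A]`: the partitions `ν` such that `s_ν` occurs with a positive coefficient in
the expansion `s_A = ∑ c_κ s_κ` (a finite sum) of the skew Schur function in Schur functions. -/
def schurSupport (A : SkewShape) : Set YoungDiagram :=
  {ν | ∃ c : YoungDiagram →₀ ℚ,
    skewSchurFunction A = Finsupp.linearCombination ℚ schurFunction c ∧ 0 < c ν}

/-- The dominance order on partitions of the same size, `lo ⪯ hi`. -/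
def DominatedBy (lo hi : YoungDiagram) : Prop :=
  lo.card = hi.card ∧
    ∀ k : ℕ, ∑ i ∈ Finset.range k, lo.rowLen i ≤ ∑ i ∈ Finset.range k, hi.rowLen i

/-- The interval `[lo, hi]` in the dominance order. -/
def dominanceInterval (lo hi : YoungDiagram) : Set YoungDiagram :=
  {ν | DominatedBy lo ν ∧ DominatedBy ν hi}

/-- The partition with the two parts `a` and `b`, that is `(a, b)` if `b ≤ a`. -/
def twoPartPartition (a b : ℕ) : YoungDiagram :=
  YoungDiagram.ofRowLens [max a b, min a b] (by
    simp [List.sortedGE_iff_pairwise])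

/-- `A` is a monotone ribbon `R_α^p`: `α` is a partition with parts at least two, `A` is a ribbon
(connected or not) whose row lengths from top to bottom are the parts of `α`, and the overlapping
partition of `A` is `p = (p₁, p₂, …, 0, 0, …)`, given here by the list of its nonzero parts. (The shape
is determined by `α` and `p` up to deletion or insertion of empty columns and of empty rows below
the ribbon, which do not affect the Schur function.) -/
structure IsMonotoneRibbon (α : YoungDiagram) (p : List ℕ) (A : SkewShape) : Prop where
  two_le : ∀ i < α.colLen 0, 2 ≤ α.rowLen i
  isRibbon : A.IsRibbon
  rowLength_eq : ∀ i, A.rowLength i = α.rowLen i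
  overlap_eq : ∀ i, A.overlap i = p.getD i 0

/-! By the Littlewood–Richardson rule, `ν` lies in the support of a skew shape exactly when the
shape has a semistandard Yamanouchi filling of content `ν` (`mem_schurSupport_iff`). The rule is
proved by Stembridge's argument: multiply by the Vandermonde alternant, expand over all fillings,
and cancel the non-Yamanouchi ones in pairs by a Bender–Knuth involution applied to the left of the
rightmost violation (`alternant_mul_schurPoly`).

In a ribbon whose rows have length at least two, the contents of the top `i` rows of such a filling
form a chain of partitions that grows by horizontal strips of sizes `α i`. An overlap of rows `i`
and `i + 1` becomes a descent: some box of strip `i` lies in a higher row than some box of strip `i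
+ 1`. Every such chain comes from a filling (`mem_schurSupport_iff_exists_chain`). The overlapping
partition `(d, …, 1, 0, …)` asks for the first `d` descents, with `d = 2` or `d = 3`.

Any chain forces `ν` to dominate `α`, and each descent keeps a box out of the first row, so the
support always lies in the interval. Conversely, strips are peeled off `ν`, the last one first,
while the rest stays above the remaining parts of `α` in dominance order. `AdmitsTwoDescents` and
`AdmitsThreeDescents` can be kept along the way (`exists_strip_two`, `exists_strip_three`), down to
three or four strips, where the chain is written out. The stated inequalities guarantee these
conditions throughout the interval.

If an inequality fails, the interval contains a partition without a chain: `(α₁, |α| - α₁)` in (a),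
and `(α₁ + 1, |α| - α₁ - 1)` or `(α₁, α₂, |α| - α₁ - α₂)` in (b). There the early strips leave too
little room in the top rows, and the descents would need a row that `ν` does not have. -/

/-! ### Order reversal of a finite set -/

/-- The order-reversing involution of a finite set of natural numbers. -/
noncomputable def reflect (F : Finset ℕ) (j : ℕ) : ℕ :=
  if h : j ∈ F then F.orderIsoOfFin rfl (Fin.rev ((F.orderIsoOfFin rfl).symm ⟨j, h⟩)) else j

theorem reflect_mem {F : Finset ℕ} {j : ℕ} (h : j ∈ F) : reflect F j ∈ F := by
  rw [reflect, dif_pos h]; exact Subtype.property _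

theorem reflect_reflect {F : Finset ℕ} {j : ℕ} (h : j ∈ F) : reflect F (reflect F j) = j := by
  rw [reflect, dif_pos (reflect_mem h)]
  have : (⟨reflect F j, reflect_mem h⟩ : F) =
      F.orderIsoOfFin rfl (Fin.rev ((F.orderIsoOfFin rfl).symm ⟨j, h⟩)) := by
    apply Subtype.ext; simp only [reflect, dif_pos h]
  rw [this]; simp

theorem reflect_lt_reflect {F : Finset ℕ} {j₁ j₂ : ℕ} (h₁ : j₁ ∈ F) (h₂ : j₂ ∈ F) (h : j₁ < j₂) :
    reflect F j₂ < reflect F j₁ := by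
  simp only [reflect, dif_pos h₁, dif_pos h₂]
  rw [Subtype.coe_lt_coe, OrderIso.lt_iff_lt,
    Fin.rev_lt_rev, OrderIso.lt_iff_lt]
  exact h

/-! ### Semistandard fillings and the Bender–Knuth involutions -/

/-- `T` is semistandard on the set of boxes `C`. -/
structure IsSemistandard (C : Finset (ℕ × ℕ)) (T : ℕ → ℕ → ℕ) : Prop where
  row : ∀ {i j₁ j₂ : ℕ}, j₁ < j₂ → (i, j₁) ∈ C → (i, j₂) ∈ C → T i j₁ ≤ T i j₂
  col : ∀ {i₁ i₂ j : ℕ}, i₁ < i₂ → (i₁, j) ∈ C → (i₂, j) ∈ C → T i₁ j < T i₂ j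

/-- A set of boxes that is convex in the product order, such as a skew shape. -/
abbrev IsSkew (C : Finset (ℕ × ℕ)) : Prop := (C : Set (ℕ × ℕ)).OrdConnected

theorem IsSkew.mem {C : Finset (ℕ × ℕ)} (hC : IsSkew C) {i j i' j' a b : ℕ} (h : (i, j) ∈ C)
    (h' : (i', j') ∈ C) (h₁ : i ≤ a) (h₂ : a ≤ i') (h₃ : j ≤ b) (h₄ : b ≤ j') : (a, b) ∈ C :=
  hC.out (x := (i, j)) (y := (i', j')) h h' ⟨⟨h₁, h₃⟩, ⟨h₂, h₄⟩⟩

theorem IsSkew.filter_lt {C : Finset (ℕ × ℕ)} (hC : IsSkew C) (j : ℕ) :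
    IsSkew (C.filter fun c => c.2 < j) := by
  refine ⟨fun x hx y hy z hz => ?_⟩
  simp only [Finset.coe_filter, Set.mem_ofPred_eq] at hx hy ⊢
  exact ⟨hC.out hx.1 hy.1 hz, lt_of_le_of_lt hz.2.2 hy.2⟩

theorem IsSemistandard.mono {C D : Finset (ℕ × ℕ)} {T : ℕ → ℕ → ℕ} (h : IsSemistandard C T)
    (hD : D ⊆ C) : IsSemistandard D T :=
  ⟨fun a b c => h.row a (hD b) (hD c), fun a b c => h.col a (hD b) (hD c)⟩

theorem IsSkew.isSemistandard {C : Finset (ℕ × ℕ)} {T : ℕ → ℕ → ℕ} (hC : IsSkew C)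
    (hrow : ∀ {i j₁ j₂ : ℕ}, j₁ < j₂ → (i, j₁) ∈ C → (i, j₂) ∈ C → T i j₁ ≤ T i j₂)
    (hcol : ∀ {i j : ℕ}, (i, j) ∈ C → (i + 1, j) ∈ C → T i j < T (i + 1) j) :
    IsSemistandard C T := by
  refine ⟨hrow, fun {i₁ i₂ j} h h₁ h₂ => ?_⟩
  induction i₂ with
  | zero => omega
  | succ n ih =>
    have hn : (n, j) ∈ C := hC.mem h₁ h₂ (by omega) (by omega) le_rfl le_rfl
    rcases Nat.lt_or_ge i₁ n with h' | h'
    · exact (ih h' hn).trans (hcol hn h₂)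
    · obtain rfl : i₁ = n := by omega
      exact hcol h₁ h₂

/-- The box `(i, j)` holds an entry `k` with no `k + 1` below it, or `k + 1` with no `k` above it. -/
def IsFree (C : Finset (ℕ × ℕ)) (k : ℕ) (T : ℕ → ℕ → ℕ) (i j : ℕ) : Prop :=
  (i, j) ∈ C ∧ ((T i j = k ∧ ¬ ((i + 1, j) ∈ C ∧ T (i + 1) j = k + 1)) ∨
    (T i j = k + 1 ∧ ∀ i', i' + 1 = i → ¬ ((i', j) ∈ C ∧ T i' j = k)))

open Classical in
/-- The columns of the free boxes in row `i`. -/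
noncomputable def freeCols (C : Finset (ℕ × ℕ)) (k : ℕ) (T : ℕ → ℕ → ℕ) (i : ℕ) : Finset ℕ :=
  (C.image Prod.snd).filter (IsFree C k T i)

theorem mem_freeCols {C : Finset (ℕ × ℕ)} {k : ℕ} {T : ℕ → ℕ → ℕ} {i j : ℕ} :
    j ∈ freeCols C k T i ↔ IsFree C k T i j := by
  simp only [freeCols, Finset.mem_filter, Finset.mem_image, and_iff_right_iff_imp]
  exact fun h => ⟨(i, j), h.1, rfl⟩

open Classical in
/-- The Bender–Knuth involution exchanging `k` and `k + 1`. -/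
noncomputable def benderKnuth (C : Finset (ℕ × ℕ)) (k : ℕ) (T : ℕ → ℕ → ℕ) (i j : ℕ) : ℕ :=
  -- Reversing and complementing the free word `k^a (k+1)^b` of a row gives `k^b (k+1)^a`, so the
  -- swap needs no counting of `a` and `b`.
  if IsFree C k T i j then 2 * k + 1 - T i (reflect (freeCols C k T i) j) else T i j

section BenderKnuth

variable {C : Finset (ℕ × ℕ)} {k : ℕ} {T : ℕ → ℕ → ℕ}

theorem IsFree.reflect {i j : ℕ} (h : IsFree C k T i j) :
    IsFree C k T i (reflect (freeCols C k T i) j) :=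
  mem_freeCols.1 (reflect_mem (mem_freeCols.2 h))

theorem benderKnuth_of_not_isFree {i j : ℕ} (h : ¬ IsFree C k T i j) :
    benderKnuth C k T i j = T i j := if_neg h

theorem benderKnuth_of_isFree {i j : ℕ} (h : IsFree C k T i j) :
    benderKnuth C k T i j = 2 * k + 1 - T i (reflect (freeCols C k T i) j) := if_pos h

theorem IsFree.eq_or {i j : ℕ} (h : IsFree C k T i j) : T i j = k ∨ T i j = k + 1 := by
  rcases h.2 with h | h <;> simp [h.1]

theorem IsFree.benderKnuth_eq_or {i j : ℕ} (h : IsFree C k T i j) :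
    benderKnuth C k T i j = k ∨ benderKnuth C k T i j = k + 1 := by
  rw [benderKnuth_of_isFree h]
  rcases h.reflect.eq_or with h | h <;> omega

theorem benderKnuth_of_notMem {i j : ℕ} (h : (i, j) ∉ C) : benderKnuth C k T i j = T i j :=
  benderKnuth_of_not_isFree fun h' => h h'.1

theorem IsFree.below {i j : ℕ} (h : IsFree C k T i j)
    (hT : IsSemistandard C T) (h' : (i + 1, j) ∈ C) :
    k + 2 ≤ T (i + 1) j := by
  have := hT.col (Nat.lt_add_one i) h.1 h'
  rcases h.2 with h | h
  · have : T (i + 1) j ≠ k + 1 := fun e => h.2 ⟨h', e⟩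
    omega
  · omega

theorem IsFree.above {i j : ℕ} (h : IsFree C k T (i + 1) j)
    (hT : IsSemistandard C T) (h' : (i, j) ∈ C) : T i j < k := by
  have := hT.col (Nat.lt_add_one i) h' h.1
  rcases h.2 with h | h
  · omega
  · have : T i j ≠ k := fun e => h.2 i rfl ⟨h', e⟩
    omega

theorem not_isFree_eq {i j : ℕ} (h : (i, j) ∈ C) (hf : ¬ IsFree C k T i j) (hk : T i j = k) :
    (i + 1, j) ∈ C ∧ T (i + 1) j = k + 1 := by
  by_contra hn
  exact hf ⟨h, Or.inl ⟨hk, hn⟩⟩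

theorem not_isFree_eq_succ {i j : ℕ} (h : (i, j) ∈ C) (hf : ¬ IsFree C k T i j)
    (hk : T i j = k + 1) : ∃ i', i' + 1 = i ∧ (i', j) ∈ C ∧ T i' j = k := by
  by_contra hn
  push Not at hn
  exact hf ⟨h, Or.inr ⟨hk, fun i' hi' h' => hn i' hi' h'.1 h'.2⟩⟩

/-- The delicate case is a free letter beside a non-free one. A non-free `k` to the right of a free
letter would have `k + 1` below it, and convexity would put a box below the free letter whose entry
is at least `k + 2`, breaking the lower row. The other case is symmetric, using the row above. -/
theorem benderKnuth_row (hC : IsSkew C) (hT : IsSemistandard C T) {i j₁ j₂ : ℕ} (h : j₁ < j₂)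
    (h₁ : (i, j₁) ∈ C) (h₂ : (i, j₂) ∈ C) :
    benderKnuth C k T i j₁ ≤ benderKnuth C k T i j₂ := by
  have hle := hT.row h h₁ h₂
  by_cases f₁ : IsFree C k T i j₁ <;> by_cases f₂ : IsFree C k T i j₂
  · rw [benderKnuth_of_isFree f₁, benderKnuth_of_isFree f₂]
    have := hT.row (reflect_lt_reflect (mem_freeCols.2 f₁) (mem_freeCols.2 f₂) h)
      f₂.reflect.1 f₁.reflect.1
    omega
  · rw [benderKnuth_of_not_isFree f₂]
    have e₁ := f₁.eq_or
    have e₁' := f₁.benderKnuth_eq_or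
    rcases Nat.lt_or_ge k (T i j₂) with hk | hk
    · omega
    · exfalso
      obtain ⟨hm, hv⟩ := not_isFree_eq h₂ f₂ (by omega)
      have hm' : (i + 1, j₁) ∈ C := hC.mem h₁ hm (by omega) le_rfl le_rfl h.le
      have := f₁.below hT hm'
      have := hT.row h hm' hm
      omega
  · rw [benderKnuth_of_not_isFree f₁]
    have e₂ := f₂.eq_or
    have e₂' := f₂.benderKnuth_eq_or
    rcases Nat.lt_or_ge k (T i j₁) with hk | hk
    · exfalso
      obtain ⟨i', rfl, hm, hv⟩ := not_isFree_eq_succ h₁ f₁ (by omega)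
      have hm' : (i', j₂) ∈ C := hC.mem hm h₂ le_rfl (by omega) h.le le_rfl
      have := f₂.above hT hm'
      have := hT.row h hm hm'
      omega
    · omega
  · rwa [benderKnuth_of_not_isFree f₁, benderKnuth_of_not_isFree f₂]

theorem benderKnuth_col (hT : IsSemistandard C T) {i j : ℕ} (h₁ : (i, j) ∈ C)
    (h₂ : (i + 1, j) ∈ C) :
    benderKnuth C k T i j < benderKnuth C k T (i + 1) j := by
  have hlt := hT.col (Nat.lt_add_one i) h₁ h₂
  by_cases f₁ : IsFree C k T i j
  · have := f₁.below hT h₂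
    have e := f₁.benderKnuth_eq_or
    have f₂ : ¬ IsFree C k T (i + 1) j := fun f₂ => by have := f₂.eq_or; omega
    rw [benderKnuth_of_not_isFree f₂]; omega
  · rw [benderKnuth_of_not_isFree f₁]
    by_cases f₂ : IsFree C k T (i + 1) j
    · have := f₂.above hT h₁
      have e := f₂.benderKnuth_eq_or
      omega
    · rwa [benderKnuth_of_not_isFree f₂]

theorem isSemistandard_benderKnuth (hC : IsSkew C) (hT : IsSemistandard C T) :
    IsSemistandard C (benderKnuth C k T) :=
  hC.isSemistandard (benderKnuth_row hC hT) (benderKnuth_col hT)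

theorem isFree_benderKnuth_of_isFree (hT : IsSemistandard C T) {i j : ℕ}
    (h : IsFree C k T i j) :
    IsFree C k (benderKnuth C k T) i j := by
  refine ⟨h.1, ?_⟩
  rcases h.benderKnuth_eq_or with e | e
  · refine Or.inl ⟨e, fun ⟨hm, hv⟩ => ?_⟩
    have := h.below hT hm
    have f₂ : ¬ IsFree C k T (i + 1) j := fun f₂ => by have := f₂.eq_or; omega
    rw [benderKnuth_of_not_isFree f₂] at hv
    omega
  · refine Or.inr ⟨e, fun i' hi' ⟨hm, hv⟩ => ?_⟩
    subst hi'
    have := h.above hT hm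
    have f₂ : ¬ IsFree C k T i' j := fun f₂ => by have := f₂.eq_or; omega
    rw [benderKnuth_of_not_isFree f₂] at hv
    omega

theorem isFree_benderKnuth_iff (hT : IsSemistandard C T) {i j : ℕ} :
    IsFree C k (benderKnuth C k T) i j ↔ IsFree C k T i j := by
  refine ⟨fun h => ?_, isFree_benderKnuth_of_isFree hT⟩
  by_contra hf
  have e := benderKnuth_of_not_isFree hf
  have h₁ := h.2
  rw [e] at h₁
  rcases h₁ with ⟨h₁, h₂⟩ | ⟨h₁, h₂⟩
  · obtain ⟨hm, hv⟩ := not_isFree_eq h.1 hf h₁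
    have f₂ : ¬ IsFree C k T (i + 1) j := fun f₂ => f₂.above hT h.1 |>.ne h₁
    exact h₂ ⟨hm, by rw [benderKnuth_of_not_isFree f₂, hv]⟩
  · obtain ⟨i', rfl, hm, hv⟩ := not_isFree_eq_succ h.1 hf h₁
    have f₂ : ¬ IsFree C k T i' j := fun f₂ => by have := f₂.below hT h.1; omega
    exact h₂ i' rfl ⟨hm, by rw [benderKnuth_of_not_isFree f₂, hv]⟩

theorem freeCols_benderKnuth (hT : IsSemistandard C T)
    (i : ℕ) :
    freeCols C k (benderKnuth C k T) i = freeCols C k T i := by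
  ext j; rw [mem_freeCols, mem_freeCols, isFree_benderKnuth_iff hT]

theorem benderKnuth_benderKnuth (hT : IsSemistandard C T) : benderKnuth C k (benderKnuth C k T) = T := by
  funext i j
  by_cases f : IsFree C k T i j
  · rw [benderKnuth_of_isFree ((isFree_benderKnuth_iff hT).2 f), freeCols_benderKnuth hT,
      benderKnuth_of_isFree f.reflect, reflect_reflect (mem_freeCols.2 f)]
    have := f.eq_or
    omega
  · rw [benderKnuth_of_not_isFree (fun h => f ((isFree_benderKnuth_iff hT).1 h)),
      benderKnuth_of_not_isFree f]

/-- A box with entry `k` or `k + 1` is exchanged with another box, whose entry becomes the other one. -/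
theorem exists_partner (hT : IsSemistandard C T) :
    ∃ f : ℕ × ℕ → ℕ × ℕ, ∀ c ∈ C, T c.1 c.2 = k ∨ T c.1 c.2 = k + 1 →
      f c ∈ C ∧ f (f c) = c ∧ benderKnuth C k T (f c).1 (f c).2 + T c.1 c.2 = 2 * k + 1 := by
  classical
  -- A free box is matched with its mirror image among the free boxes of its row; a non-free `k` is
  -- matched with the `k + 1` below it.
  refine ⟨fun c => if IsFree C k T c.1 c.2 then (c.1, reflect (freeCols C k T c.1) c.2)
    else if T c.1 c.2 = k then (c.1 + 1, c.2) else (c.1 - 1, c.2), ?_⟩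
  rintro ⟨i, j⟩ hc hk
  by_cases f : IsFree C k T i j
  · simp only [f, if_true, f.reflect, reflect_reflect (mem_freeCols.2 f)]
    refine ⟨f.reflect.1, trivial, ?_⟩
    rw [benderKnuth_of_isFree f.reflect, reflect_reflect (mem_freeCols.2 f)]
    simp only at hk
    omega
  · rcases hk with hk | hk
    · simp only at hk
      obtain ⟨hm, hv⟩ := not_isFree_eq hc f hk
      have f₂ : ¬ IsFree C k T (i + 1) j := fun f₂ => f₂.above hT hc |>.ne hk
      simp [f, hk, f₂, hv, hm, benderKnuth_of_not_isFree f₂]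
      omega
    · simp only at hk
      obtain ⟨i', rfl, hm, hv⟩ := not_isFree_eq_succ hc f hk
      have f₂ : ¬ IsFree C k T i' j := fun f₂ => by have := f₂.below hT hc; omega
      simp [f, hk, f₂, hv, hm, benderKnuth_of_not_isFree f₂]
      omega

end BenderKnuth

/-- The number of entries `k` in the boxes `C`. -/
def entryCount (C : Finset (ℕ × ℕ)) (T : ℕ → ℕ → ℕ) (k : ℕ) : ℕ :=
  (C.filter fun c => T c.1 c.2 = k).card

theorem entryCount_congr {C : Finset (ℕ × ℕ)} {T T' : ℕ → ℕ → ℕ}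
    (h : ∀ c ∈ C, T c.1 c.2 = T' c.1 c.2) : entryCount C T = entryCount C T' := by
  funext k
  unfold entryCount
  congr 1
  exact Finset.filter_congr fun c hc => by rw [h c hc]

theorem entryCount_benderKnuth {C : Finset (ℕ × ℕ)} {T : ℕ → ℕ → ℕ} (hC : IsSkew C)
    (hT : IsSemistandard C T) (k x : ℕ) :
    entryCount C (benderKnuth C k T) x = entryCount C T (Equiv.swap k (k + 1) x) := by
  -- One injection suffices: applied to `T` and to its image under the involution, it gives both
  -- inequalities.
  have key : ∀ T, IsSemistandard C T → ∀ a b, a + b = 2 * k + 1 → (a = k ∨ a = k + 1) →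
      entryCount C T a ≤ entryCount C (benderKnuth C k T) b := by
    intro T hT a b hab ha
    obtain ⟨f, hf⟩ := exists_partner (k := k) hT
    refine Finset.card_le_card_of_injOn f ?_ ?_
    · intro c hc
      simp only [Finset.coe_filter, Set.mem_ofPred_eq] at hc ⊢
      obtain ⟨h₁, h₂, h₃⟩ := hf c hc.1 (by omega)
      exact ⟨h₁, by omega⟩
    · intro c hc d hd hcd
      simp only [Finset.coe_filter, Set.mem_ofPred_eq] at hc hd
      rw [← (hf c hc.1 (by omega)).2.1, hcd, (hf d hd.1 (by omega)).2.1]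
  have key' : ∀ a b, a + b = 2 * k + 1 → (a = k ∨ a = k + 1) →
      entryCount C (benderKnuth C k T) b = entryCount C T a := by
    intro a b hab ha
    refine le_antisymm ?_ (key T hT a b hab ha)
    have := key _ (isSemistandard_benderKnuth (k := k) hC hT) b a (by omega) (by omega)
    rwa [benderKnuth_benderKnuth hT] at this
  by_cases h₁ : x = k
  · subst h₁; rw [Equiv.swap_apply_left]; exact key' _ _ (by omega) (by omega)
  by_cases h₂ : x = k + 1
  · subst h₂; rw [Equiv.swap_apply_right]; exact key' _ _ (by omega) (by omega)
  rw [Equiv.swap_apply_of_ne_of_ne h₁ h₂]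
  unfold entryCount
  congr 1
  refine Finset.filter_congr fun c _ => ?_
  by_cases f : IsFree C k T c.1 c.2
  · have := f.eq_or
    have := f.benderKnuth_eq_or
    omega
  · rw [benderKnuth_of_not_isFree f]

/-! ### Alternants and the Littlewood–Richardson rule in finitely many variables -/

section Alternant

open MvPolynomial

/-- The alternant `det (x_i ^ γ_j)`. -/
noncomputable def alternant {N : ℕ} (γ : Fin N → ℕ) : MvPolynomial (Fin N) ℚ :=
  (Matrix.of fun i j => (X i : MvPolynomial (Fin N) ℚ) ^ γ j).det

/-- The monomial with exponent vector `γ`. -/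
noncomputable def powProd {N : ℕ} (γ : Fin N → ℕ) : MvPolynomial (Fin N) ℚ :=
  ∏ i, X i ^ γ i

/-- The exponents `N - 1, …, 1, 0`. -/
def staircase (N : ℕ) (i : Fin N) : ℕ := N - 1 - i

variable {N : ℕ}

theorem powProd_eq_monomial (γ : Fin N → ℕ) :
    powProd γ = monomial (Finsupp.equivFunOnFinite.symm γ) 1 := by
  rw [monomial_eq, C_1, one_mul, Finsupp.prod_fintype _ _ (by simp)]
  rfl

theorem powProd_add (γ γ' : Fin N → ℕ) : powProd (γ + γ') = powProd γ * powProd γ' := by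
  simp [powProd, pow_add, Finset.prod_mul_distrib]

theorem rename_powProd (σ : Equiv.Perm (Fin N)) (γ : Fin N → ℕ) :
    rename σ (powProd γ) = powProd (γ ∘ σ.symm) := by
  simp only [powProd, map_prod, map_pow, rename_X]
  exact Fintype.prod_equiv σ _ _ (by simp)

theorem alternant_eq_sum (γ : Fin N → ℕ) :
    alternant γ = ∑ σ : Equiv.Perm (Fin N), σ.sign • rename σ (powProd γ) := by
  simp [alternant, Matrix.det_apply, powProd]

theorem alternant_comp (γ : Fin N → ℕ) (σ : Equiv.Perm (Fin N)) :
    alternant (γ ∘ σ) = σ.sign • alternant γ := by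
  have := Matrix.det_permute' σ (Matrix.of fun i j => (X i : MvPolynomial (Fin N) ℚ) ^ γ j)
  rw [alternant, alternant, Units.smul_def, zsmul_eq_mul, ← this]
  rfl

theorem alternant_mul (γ : Fin N → ℕ) {p : MvPolynomial (Fin N) ℚ}
    (hp : ∀ σ : Equiv.Perm (Fin N), rename σ p = p) :
    alternant γ * p = ∑ σ : Equiv.Perm (Fin N), σ.sign • rename σ (powProd γ * p) := by
  rw [alternant_eq_sum, Finset.sum_mul]
  refine Finset.sum_congr rfl fun σ _ => ?_
  rw [map_mul, hp, smul_mul_assoc]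

theorem alternant_staircase_ne_zero (N : ℕ) : alternant (staircase N) ≠ 0 := by
  have h : staircase N ∘ (Fin.revPerm : Equiv.Perm (Fin N)) = fun i : Fin N => (i : ℕ) := by
    funext i; simp [staircase]; omega
  have h' : alternant (fun i : Fin N => (i : ℕ)) ≠ 0 := by
    have : alternant (fun i : Fin N => (i : ℕ)) =
      (Matrix.vandermonde (X : Fin N → MvPolynomial (Fin N) ℚ)).det := rfl
    rw [this, Matrix.det_vandermonde_ne_zero_iff]
    exact X_injective
  intro h0
  apply h'
  rw [← h, alternant_comp, h0, smul_zero]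

/-- Only the identity permutation keeps a strictly decreasing exponent vector decreasing, so each
alternant has exactly one monomial of this kind. This separates the alternants and serves as linear
independence. -/
theorem coeff_alternant {γ γ' : Fin N → ℕ} (hγ : StrictAnti γ) (hγ' : StrictAnti γ') :
    coeff (Finsupp.equivFunOnFinite.symm γ') (alternant γ) = if γ = γ' then 1 else 0 := by
  rw [alternant_eq_sum, coeff_sum]
  have key : ∀ σ : Equiv.Perm (Fin N), γ ∘ σ.symm = γ' → σ = 1 := by
    intro σ h
    have hmono : StrictMono σ.symm := by
      intro a b hab
      have := hγ' hab
      rw [← h] at this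
      exact hγ.lt_iff_gt.1 this
    have : (hmono.orderIsoOfSurjective _ σ.symm.surjective) = OrderIso.refl _ :=
      Subsingleton.elim _ _
    ext i
    have h2 := congrArg (fun f => f (σ i)) this
    simp at h2
    simp [← h2]
  rw [Finset.sum_eq_single 1]
  · simp only [Equiv.Perm.sign_one, one_smul, Equiv.Perm.coe_one, rename_id_apply,
      powProd_eq_monomial, coeff_monomial, Finsupp.equivFunOnFinite.symm.injective.eq_iff]
  · intro σ _ hσ
    rw [rename_powProd, powProd_eq_monomial, Units.smul_def, coeff_smul, coeff_monomial, if_neg,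
      smul_zero]
    rw [Finsupp.equivFunOnFinite.symm.injective.eq_iff]
    exact fun h => hσ (key σ h)
  · simp

end Alternant

/-! ### Sums over semistandard fillings -/

theorem finite_tableaux (C : Finset (ℕ × ℕ)) (N : ℕ) :
    {T : ℕ → ℕ → ℕ | IsSemistandard C T ∧ (∀ i j, (i, j) ∉ C → T i j = 0) ∧
      ∀ c ∈ C, T c.1 c.2 < N}.Finite := by
  classical
  refine (Set.finite_range fun (f : C → Fin N) (i j : ℕ) =>
    if h : (i, j) ∈ C then (f ⟨(i, j), h⟩ : ℕ) else 0).subset ?_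
  rintro T ⟨-, h₀, hN⟩
  refine ⟨fun c => ⟨T c.1.1 c.1.2, hN _ c.2⟩, ?_⟩
  funext i j
  by_cases h : (i, j) ∈ C
  · simp [h]
  · simp [h, h₀ i j h]

/-- The semistandard fillings of `C` with entries less than `N`. -/
noncomputable def tableaux (C : Finset (ℕ × ℕ)) (N : ℕ) : Finset (ℕ → ℕ → ℕ) :=
  (finite_tableaux C N).toFinset

theorem mem_tableaux {C : Finset (ℕ × ℕ)} {N : ℕ} {T : ℕ → ℕ → ℕ} :
    T ∈ tableaux C N ↔ IsSemistandard C T ∧ (∀ i j, (i, j) ∉ C → T i j = 0) ∧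
      ∀ c ∈ C, T c.1 c.2 < N := by
  simp [tableaux]

/-- The exponent vector of a filling. -/
def exponent (C : Finset (ℕ × ℕ)) (N : ℕ) (T : ℕ → ℕ → ℕ) (i : Fin N) : ℕ := entryCount C T i

/-- The Schur polynomial of `C` in `N` variables. -/
noncomputable def schurPoly (C : Finset (ℕ × ℕ)) (N : ℕ) : MvPolynomial (Fin N) ℚ :=
  ∑ T ∈ tableaux C N, powProd (exponent C N T)

theorem benderKnuth_mem_tableaux {C D : Finset (ℕ × ℕ)} {N k : ℕ} {T : ℕ → ℕ → ℕ} (hD : D ⊆ C)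
    (hT : T ∈ tableaux C N) (hk : k + 1 < N) (h : IsSemistandard C (benderKnuth D k T)) :
    benderKnuth D k T ∈ tableaux C N := by
  rw [mem_tableaux] at hT ⊢
  refine ⟨h, fun i j hij => ?_, fun c hc => ?_⟩
  · rw [benderKnuth_of_notMem fun h' => hij (hD h'), hT.2.1 i j hij]
  · by_cases f : IsFree D k T c.1 c.2
    · have := f.benderKnuth_eq_or
      omega
    · rw [benderKnuth_of_not_isFree f]
      exact hT.2.2 c hc

theorem val_swap {N k : ℕ} (hk : k + 1 < N) (i : Fin N) :
    ((Equiv.swap (⟨k, by omega⟩ : Fin N) ⟨k + 1, hk⟩ i : Fin N) : ℕ) = Equiv.swap k (k + 1) i := by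
  rw [Equiv.swap_apply_def, Equiv.swap_apply_def]
  simp only [Fin.ext_iff]
  split_ifs <;> rfl

theorem rename_swap_schurPoly {C : Finset (ℕ × ℕ)} (hC : IsSkew C) {N k : ℕ} (hk : k + 1 < N) :
    MvPolynomial.rename (Equiv.swap (⟨k, by omega⟩ : Fin N) ⟨k + 1, hk⟩) (schurPoly C N) =
      schurPoly C N := by
  have hmem : ∀ T ∈ tableaux C N, benderKnuth C k T ∈ tableaux C N := fun T hT =>
    benderKnuth_mem_tableaux subset_rfl hT hk (isSemistandard_benderKnuth hC (mem_tableaux.1 hT).1)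
  rw [schurPoly, map_sum]
  refine Finset.sum_nbij' (benderKnuth C k) (benderKnuth C k) hmem hmem
    (fun T hT => benderKnuth_benderKnuth (mem_tableaux.1 hT).1)
    (fun T hT => benderKnuth_benderKnuth (mem_tableaux.1 hT).1) fun T hT => ?_
  rw [rename_powProd]
  congr 1
  funext i
  rw [exponent, entryCount_benderKnuth hC (mem_tableaux.1 hT).1, ← val_swap hk]
  simp [exponent]

theorem rename_schurPoly {C : Finset (ℕ × ℕ)} (hC : IsSkew C) {N : ℕ} (σ : Equiv.Perm (Fin N)) :
    MvPolynomial.rename σ (schurPoly C N) = schurPoly C N := by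
  rcases N with _ | n
  · rw [Subsingleton.elim σ 1]
    exact MvPolynomial.rename_id_apply _
  have h : σ ∈ Submonoid.closure
      (Set.range fun i : Fin n => Equiv.swap i.castSucc i.succ) := by
    rw [Equiv.Perm.mclosure_swap_castSucc_succ]; trivial
  induction h using Submonoid.closure_induction with
  | mem x hx =>
    obtain ⟨i, rfl⟩ := hx
    exact rename_swap_schurPoly hC (k := i) (by omega)
  | one => exact MvPolynomial.rename_id_apply _
  | mul x y _ _ hx hy =>
    rw [Equiv.Perm.coe_mul, ← MvPolynomial.rename_rename, hy, hx]

/-- Since the Schur polynomial is symmetric, it can be moved inside the antisymmetrisation of `x^γ`;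
each filling then contributes one alternant. -/
theorem alternant_mul_schurPoly_eq_sum {C : Finset (ℕ × ℕ)} (hC : IsSkew C) {N : ℕ}
    (γ : Fin N → ℕ) :
    alternant γ * schurPoly C N = ∑ T ∈ tableaux C N, alternant (exponent C N T + γ) := by
  rw [alternant_mul γ (rename_schurPoly hC)]
  simp only [schurPoly, Finset.mul_sum, map_sum, Finset.smul_sum]
  rw [Finset.sum_comm]
  refine Finset.sum_congr rfl fun T _ => ?_
  rw [alternant_eq_sum]
  refine Finset.sum_congr rfl fun σ _ => ?_
  rw [powProd_add, mul_comm]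

/-! ### The cancellation -/

/-- The boxes in the columns `j, j + 1, …`. -/
def rightCols (C : Finset (ℕ × ℕ)) (j : ℕ) : Finset (ℕ × ℕ) := C.filter fun c => j ≤ c.2

/-- The boxes in the columns to the left of `j`. -/
def leftCols (C : Finset (ℕ × ℕ)) (j : ℕ) : Finset (ℕ × ℕ) := C.filter fun c => c.2 < j

/-- For each `j` the entries in the columns `j, j + 1, …` form a partition. -/
def IsYamanouchi (C : Finset (ℕ × ℕ)) (T : ℕ → ℕ → ℕ) : Prop :=
  ∀ j k, entryCount (rightCols C j) T (k + 1) ≤ entryCount (rightCols C j) T k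

theorem entryCount_rightCols_add_leftCols (C : Finset (ℕ × ℕ)) (T : ℕ → ℕ → ℕ) (j k : ℕ) :
    entryCount (rightCols C j) T k + entryCount (leftCols C j) T k = entryCount C T k := by
  unfold entryCount rightCols leftCols
  rw [Finset.filter_filter, Finset.filter_filter, ← Finset.card_filter_add_card_filter_not
    (s := C.filter fun c => T c.1 c.2 = k) (fun c => j ≤ c.2), Finset.filter_filter,
    Finset.filter_filter]
  congr 2 <;> ext c <;> simp <;> tauto

/-- `j` is the rightmost column, and `k` the least letter, at which the filling is not Yamanouchi. -/
def IsCut (C : Finset (ℕ × ℕ)) (T : ℕ → ℕ → ℕ) (p : ℕ × ℕ) : Prop :=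
  entryCount (rightCols C p.1) T p.2 < entryCount (rightCols C p.1) T (p.2 + 1) ∧
  (∀ j > p.1, ∀ k, entryCount (rightCols C j) T (k + 1) ≤ entryCount (rightCols C j) T k) ∧
  ∀ k < p.2, entryCount (rightCols C p.1) T (k + 1) ≤ entryCount (rightCols C p.1) T k

theorem IsCut.unique {C : Finset (ℕ × ℕ)} {T : ℕ → ℕ → ℕ} {p q : ℕ × ℕ} (hp : IsCut C T p)
    (hq : IsCut C T q) : p = q := by
  obtain ⟨j, k⟩ := p
  obtain ⟨j', k'⟩ := q
  have hj : j = j' := by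
    rcases lt_trichotomy j j' with h | h | h
    · exact absurd hq.1 (not_lt.2 (hp.2.1 _ h _))
    · exact h
    · exact absurd hp.1 (not_lt.2 (hq.2.1 _ h _))
  subst hj
  rcases lt_trichotomy k k' with h | h | h
  · exact absurd hp.1 (not_lt.2 (hq.2.2 _ h))
  · rw [h]
  · exact absurd hq.1 (not_lt.2 (hp.2.2 _ h))

theorem exists_isCut {C : Finset (ℕ × ℕ)} {T : ℕ → ℕ → ℕ} (h : ¬ IsYamanouchi C T) :
    ∃ p, IsCut C T p := by
  classical
  let P : ℕ → Prop := fun j =>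
    ∃ k, entryCount (rightCols C j) T k < entryCount (rightCols C j) T (k + 1)
  have hP : ∃ j, P j := by
    simpa only [IsYamanouchi, not_forall, not_le] using h
  have hbound : ∀ j, P j → j ≤ C.sup Prod.snd := by
    rintro j ⟨k, hk⟩
    obtain ⟨c, hc⟩ := Finset.card_pos.1 (lt_of_le_of_lt (Nat.zero_le _) hk)
    simp only [rightCols, Finset.mem_filter] at hc
    exact hc.1.2.trans (Finset.le_sup (f := Prod.snd) hc.1.1)
  obtain ⟨j₀, hj₀⟩ := hP
  have hj : P (Nat.findGreatest P (C.sup Prod.snd)) :=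
    Nat.findGreatest_spec (hbound _ hj₀) hj₀
  set j := Nat.findGreatest P (C.sup Prod.snd) with hjdef
  refine ⟨(j, Nat.find hj), Nat.find_spec hj, fun j' hj' k => ?_, fun k hk => ?_⟩
  · by_contra hlt
    have hPj : P j' := ⟨k, not_le.1 hlt⟩
    have := Nat.le_findGreatest (hbound _ hPj) hPj
    omega
  · exact not_lt.1 (Nat.find_min hj hk)

section Cut

variable {C : Finset (ℕ × ℕ)} {T : ℕ → ℕ → ℕ} {j k : ℕ}

theorem benderKnuth_leftCols {i j' : ℕ} (h : j ≤ j') :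
    benderKnuth (leftCols C j) k T i j' = T i j' :=
  benderKnuth_of_notMem fun h' => by simp [leftCols] at h'; omega

theorem entryCount_rightCols_benderKnuth {j' : ℕ} (h : j ≤ j') :
    entryCount (rightCols C j') (benderKnuth (leftCols C j) k T) =
      entryCount (rightCols C j') T :=
  entryCount_congr fun c hc => benderKnuth_leftCols (by simp [rightCols] at hc; omega)

theorem IsCut.benderKnuth (h : IsCut C T (j, k)) :
    IsCut C (benderKnuth (leftCols C j) k T) (j, k) := by
  refine ⟨?_, fun j' hj' k' => ?_, fun k' hk' => ?_⟩
  · rw [entryCount_rightCols_benderKnuth le_rfl]; exact h.1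
  · rw [entryCount_rightCols_benderKnuth (le_of_lt hj')]; exact h.2.1 j' hj' k'
  · rw [entryCount_rightCols_benderKnuth le_rfl]; exact h.2.2 k' hk'

/-- The number of entries `k` in column `j`. -/
def colCount (C : Finset (ℕ × ℕ)) (T : ℕ → ℕ → ℕ) (j k : ℕ) : ℕ :=
  (C.filter fun c => c.2 = j ∧ T c.1 c.2 = k).card

theorem entryCount_rightCols_succ (C : Finset (ℕ × ℕ)) (T : ℕ → ℕ → ℕ) (j k : ℕ) :
    entryCount (rightCols C j) T k = entryCount (rightCols C (j + 1)) T k + colCount C T j k := by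
  unfold entryCount rightCols colCount
  rw [← Finset.card_union_of_disjoint]
  · congr 1
    ext c
    simp only [Finset.mem_filter, Finset.mem_union]
    constructor
    · rintro ⟨⟨h₁, h₂⟩, h₃⟩
      rcases h₂.lt_or_eq with h | h
      · exact Or.inl ⟨⟨h₁, h⟩, h₃⟩
      · exact Or.inr ⟨h₁, h.symm, h₃⟩
    · rintro (⟨⟨h₁, h₂⟩, h₃⟩ | ⟨h₁, h₂, h₃⟩)
      · exact ⟨⟨h₁, by omega⟩, h₃⟩
      · exact ⟨⟨h₁, by omega⟩, h₃⟩
  · rw [Finset.disjoint_left]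
    intro c h₁ h₂
    simp only [Finset.mem_filter] at h₁ h₂
    omega

theorem colCount_le_one (hT : IsSemistandard C T) (j k : ℕ) : colCount C T j k ≤ 1 := by
  refine Finset.card_le_one.2 fun a ha b hb => ?_
  obtain ⟨a₁, a₂⟩ := a
  obtain ⟨b₁, b₂⟩ := b
  simp only [Finset.mem_filter] at ha hb
  obtain ⟨ha, rfl, ha'⟩ := ha
  obtain ⟨hb, rfl, hb'⟩ := hb
  rcases lt_trichotomy a₁ b₁ with h | h | h
  · have := hT.col h ha hb; omega
  · rw [h]
  · have := hT.col h hb ha; omega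

/-- To the right of `j` there is no violation, and a column holds each letter at most once. So
column `j` creates the violation by a margin of exactly one, with a `k + 1` and no `k`. -/
theorem IsCut.counts (h : IsCut C T (j, k)) (hT : IsSemistandard C T) :
    entryCount (rightCols C j) T (k + 1) = entryCount (rightCols C j) T k + 1 ∧
      ∀ i, (i, j) ∈ C → T i j ≠ k := by
  have h₁ := h.1
  have h₂ := h.2.1 (j + 1) (by simp) k
  have h₃ := colCount_le_one hT j (k + 1)
  have e₁ := entryCount_rightCols_succ C T j k
  have e₂ := entryCount_rightCols_succ C T j (k + 1)
  simp only at h₁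
  refine ⟨by omega, fun i hi hk => ?_⟩
  have : 0 < colCount C T j k := Finset.card_pos.2 ⟨(i, j), by simp [hi, hk]⟩
  omega

/-- Only the border between the changed columns and column `j` matters. A `k` raised to `k + 1`
there is harmless, because column `j` contains no `k`. -/
theorem IsCut.isSemistandard (h : IsCut C T (j, k)) (hC : IsSkew C) (hT : IsSemistandard C T) :
    IsSemistandard C (_root_.benderKnuth (leftCols C j) k T) := by
  have hS : IsSemistandard (leftCols C j) (_root_.benderKnuth (leftCols C j) k T) :=
    isSemistandard_benderKnuth (hC.filter_lt j) (hT.mono (Finset.filter_subset _ _))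
  have hl : ∀ {a b}, b < j → (a, b) ∈ C → (a, b) ∈ leftCols C j := fun hb hab => by
    simp [leftCols, hb, hab]
  refine ⟨fun {i j₁ j₂} hj h₁ h₂ => ?_, fun {i₁ i₂ j'} hi h₁ h₂ => ?_⟩
  · rcases Nat.lt_or_ge j₂ j with hj₂ | hj₂
    · exact hS.row hj (hl (hj.trans hj₂) h₁) (hl hj₂ h₂)
    rw [benderKnuth_leftCols hj₂]
    have hle := hT.row hj h₁ h₂
    by_cases f : IsFree (leftCols C j) k T i j₁
    · have e := f.eq_or
      have e' := f.benderKnuth_eq_or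
      have hlt : j₁ < j := by have := f.1; simp [leftCols] at this; omega
      have hm : (i, j) ∈ C := hC.mem h₁ h₂ le_rfl le_rfl hlt.le hj₂
      have hne := (h.counts hT).2 i hm
      have hle₁ := hT.row hlt h₁ hm
      have hle₂ : T i j ≤ T i j₂ := by
        rcases hj₂.lt_or_eq with h' | h'
        · exact hT.row h' hm h₂
        · rw [h']
      omega
    · rwa [benderKnuth_of_not_isFree f]
  · rcases Nat.lt_or_ge j' j with hj' | hj'
    · exact hS.col hi (hl hj' h₁) (hl hj' h₂)
    · rw [benderKnuth_leftCols hj', benderKnuth_leftCols hj']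
      exact hT.col hi h₁ h₂

/-- The involution swaps the counts of `k` and `k + 1` on the left. On the right `k + 1` is ahead by
one, which the staircase compensates, so the shifted exponent vector is changed exactly by the
transposition. -/
theorem IsCut.alternant_benderKnuth (h : IsCut C T (j, k)) (hC : IsSkew C)
    (hT : IsSemistandard C T) {N : ℕ} (hk : k + 1 < N) :
    alternant (exponent C N (_root_.benderKnuth (leftCols C j) k T) + staircase N) =
      -alternant (exponent C N T + staircase N) := by
  have key : exponent C N (_root_.benderKnuth (leftCols C j) k T) + staircase N =
      (exponent C N T + staircase N) ∘
        Equiv.swap (⟨k, by omega⟩ : Fin N) ⟨k + 1, hk⟩ := by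
    funext i
    have hval := val_swap hk i
    simp only [Pi.add_apply, Function.comp_apply, exponent, staircase, hval]
    have hc := (h.counts hT).1
    rw [← entryCount_rightCols_add_leftCols C _ j, ← entryCount_rightCols_add_leftCols C T j,
      entryCount_rightCols_benderKnuth le_rfl,
      entryCount_benderKnuth (C := leftCols C j) (hC.filter_lt j)
        (hT.mono (Finset.filter_subset _ _))]
    by_cases h₁ : (i : ℕ) = k
    · rw [h₁, Equiv.swap_apply_left]; omega
    by_cases h₂ : (i : ℕ) = k + 1
    · rw [h₂, Equiv.swap_apply_right]; omega
    rw [Equiv.swap_apply_of_ne_of_ne h₁ h₂]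
  rw [key, alternant_comp, Equiv.Perm.sign_swap (by simp [Fin.ext_iff])]
  simp

end Cut

open Classical in
/-- **The Littlewood–Richardson rule** (Stembridge's form), multiplied by the Vandermonde alternant. -/
theorem alternant_mul_schurPoly {C : Finset (ℕ × ℕ)} (hC : IsSkew C) (N : ℕ) :
    alternant (staircase N) * schurPoly C N =
      ∑ T ∈ (tableaux C N).filter (IsYamanouchi C), alternant (exponent C N T + staircase N) := by
  rw [alternant_mul_schurPoly_eq_sum hC, ← Finset.sum_filter_add_sum_filter_not _ (IsYamanouchi C)]
  -- The remaining sum vanishes: the columns from the cut on are untouched, so the cut survives and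
  -- the pairing is an involution that changes the sign of the alternant.
  refine add_eq_left.2 ?_
  choose! p hp using fun (T : ℕ → ℕ → ℕ) (h : ¬ IsYamanouchi C T) => exists_isCut h
  have hN : ∀ T ∈ tableaux C N, ∀ j k, IsCut C T (j, k) → k + 1 < N := by
    intro T hT j k h
    obtain ⟨c, hc⟩ := Finset.card_pos.1 (lt_of_le_of_lt (Nat.zero_le _) h.1)
    simp only [rightCols, Finset.mem_filter] at hc
    rw [← hc.2]
    exact (mem_tableaux.1 hT).2.2 c hc.1.1
  have hcut : ∀ T, ¬ IsYamanouchi C T → IsCut C (benderKnuth (leftCols C (p T).1) (p T).2 T) (p T) :=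
    fun T h => (hp T h).benderKnuth
  have hbad : ∀ T q, IsCut C T q → ¬ IsYamanouchi C T := fun T q h h' =>
    absurd h.1 (not_lt.2 (h' _ _))
  have hneg : ∀ T ∈ tableaux C N, ¬ IsYamanouchi C T →
      alternant (exponent C N (benderKnuth (leftCols C (p T).1) (p T).2 T) + staircase N) =
        -alternant (exponent C N T + staircase N) := fun T hT h =>
    (hp T h).alternant_benderKnuth hC (mem_tableaux.1 hT).1 (hN T hT _ _ (hp T h))
  refine Finset.sum_involution (fun T _ => benderKnuth (leftCols C (p T).1) (p T).2 T)
    (fun T hT => ?_) (fun T hT hne heq => ?_) (fun T hT => ?_) fun T hT => ?_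
  all_goals obtain ⟨hT, hY⟩ := Finset.mem_filter.1 hT
  · rw [hneg T hT hY, add_neg_cancel]
  · have := hneg T hT hY
    rw [heq] at this
    exact hne (self_eq_neg.1 this)
  · refine Finset.mem_filter.2 ⟨benderKnuth_mem_tableaux (Finset.filter_subset _ _) hT
      (hN T hT _ _ (hp T hY)) ((hp T hY).isSemistandard hC (mem_tableaux.1 hT).1),
      hbad _ _ (hcut T hY)⟩
  · have e : p (benderKnuth (leftCols C (p T).1) (p T).2 T) = p T :=
      (hp _ (hbad _ _ (hcut T hY))).unique (hcut T hY)
    simp only [e]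
    exact benderKnuth_benderKnuth ((mem_tableaux.1 hT).1.mono (Finset.filter_subset _ _))

/-! ### Straight shapes -/

theorem isSkew_cells (μ : YoungDiagram) : IsSkew μ.cells :=
  ⟨fun _ _ _ hy _ hz => μ.isLowerSet hz.2 hy⟩

theorem SkewShape.isSkew_cells (A : SkewShape) : IsSkew A.cells := by
  refine ⟨fun x hx y hy z hz => ?_⟩
  simp only [SkewShape.cells, Finset.coe_sdiff] at hx hy ⊢
  exact ⟨A.outer.isLowerSet hz.2 hy.1, fun h => hx.2 (A.inner.isLowerSet hz.1 h)⟩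

theorem IsYamanouchi.antitone {C : Finset (ℕ × ℕ)} {T : ℕ → ℕ → ℕ} (h : IsYamanouchi C T) (j : ℕ) :
    Antitone (entryCount (rightCols C j) T) :=
  antitone_nat_of_succ_le (h j)

theorem rightCols_zero (C : Finset (ℕ × ℕ)) : rightCols C 0 = C := by simp [rightCols]

theorem IsYamanouchi.antitone_entryCount {C : Finset (ℕ × ℕ)} {T : ℕ → ℕ → ℕ}
    (h : IsYamanouchi C T) : Antitone (entryCount C T) := by
  simpa only [rightCols_zero] using h.antitone 0

theorem IsYamanouchi.lt_card {C : Finset (ℕ × ℕ)} {T : ℕ → ℕ → ℕ} (h : IsYamanouchi C T)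
    {k : ℕ} (hk : 0 < entryCount C T k) : k < C.card := by
  have hsub : Finset.range (k + 1) ⊆ C.image fun c => T c.1 c.2 := by
    intro r hr
    have : 0 < entryCount C T r :=
      hk.trans_le (h.antitone_entryCount (Nat.lt_succ_iff.1 (Finset.mem_range.1 hr)))
    obtain ⟨c, hc⟩ := Finset.card_pos.1 this
    rw [Finset.mem_filter] at hc
    exact Finset.mem_image.2 ⟨c, hc⟩
  have := (Finset.card_le_card hsub).trans Finset.card_image_le
  rw [Finset.card_range] at this
  omega

/-- Entries are never smaller than their row index. Take the rightmost column with an entry that is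
too large, and the topmost such box `(p, q)` in it. By the Yamanouchi property some letter `p`
occurs in the columns from `q` on; it must sit above row `p`, hence is itself too large, and lies
further right or higher up. -/
theorem IsYamanouchi.eq_row {μ : YoungDiagram} {T : ℕ → ℕ → ℕ} (hT : IsSemistandard μ.cells T)
    (hY : IsYamanouchi μ.cells T) {i j : ℕ} (h : (i, j) ∈ μ.cells) : T i j = i := by
  have hge : ∀ i j, (i, j) ∈ μ.cells → i ≤ T i j := by
    intro i j
    induction i with
    | zero => intro _; exact Nat.zero_le _
    | succ n ih =>
      intro h
      have h' : (n, j) ∈ μ.cells := μ.up_left_mem (by omega) le_rfl h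
      have := ih h'
      have := hT.col (Nat.lt_add_one n) h' h
      omega
  by_contra hne
  let B := μ.cells.filter fun c => c.1 < T c.1 c.2
  have hB : B.Nonempty := ⟨(i, j), Finset.mem_filter.2 ⟨h, lt_of_le_of_ne (hge i j h) (Ne.symm hne)⟩⟩
  obtain ⟨c, hc, hmax⟩ := Finset.exists_max_image B Prod.snd hB
  obtain ⟨d, hd, hmin⟩ := Finset.exists_min_image (B.filter fun d => d.2 = c.2) Prod.fst
    ⟨c, Finset.mem_filter.2 ⟨hc, rfl⟩⟩
  obtain ⟨p, q⟩ := d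
  simp only [Finset.mem_filter, B] at hd hmin hmax
  obtain ⟨⟨hd, hlt⟩, hq⟩ := hd
  rw [← hq] at hmax
  have hright : (p, q + 1) ∉ μ.cells := by
    intro hm
    have := hT.row (Nat.lt_add_one q) hd hm
    have := hmax (p, q + 1) ⟨hm, by simp only; omega⟩
    simp at this
  have hpos : 0 < entryCount (rightCols μ.cells q) T (T p q) :=
    Finset.card_pos.2 ⟨(p, q), by simp only [rightCols, Finset.mem_filter]; exact ⟨⟨hd, le_rfl⟩, trivial⟩⟩
  have hpos' := hpos.trans_le (hY.antitone q hlt.le)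
  obtain ⟨⟨a, b⟩, he⟩ := Finset.card_pos.1 hpos'
  simp only [rightCols, Finset.mem_filter] at he
  obtain ⟨⟨hm, hb⟩, ha⟩ := he
  rcases hb.lt_or_eq with hb | rfl
  · have hap : a < p := by
      by_contra hap
      exact hright (μ.up_left_mem (not_lt.1 hap) hb hm)
    have := hmax (a, b) ⟨hm, by simp only; omega⟩
    simp only at this
    omega
  · have := hge a q hm
    have hap : a ≠ p := by rintro rfl; omega
    have := hmin (a, q) ⟨⟨hm, by simp only; omega⟩, hq⟩
    simp only at this
    omega

theorem entryCount_rightCols_highestWeight (μ : YoungDiagram) (j k : ℕ) :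
    entryCount (rightCols μ.cells j) (SemistandardYoungTableau.highestWeight μ) k =
      μ.rowLen k - j := by
  have : (rightCols μ.cells j).filter
      (fun c => SemistandardYoungTableau.highestWeight μ c.1 c.2 = k) =
      (Finset.Ico j (μ.rowLen k)).image fun b => (k, b) := by
    ext ⟨a, b⟩
    rw [Finset.mem_filter, rightCols, Finset.mem_filter, Finset.mem_image, YoungDiagram.mem_cells]
    simp only [Finset.mem_Ico, Prod.mk.injEq, SemistandardYoungTableau.highestWeight_apply]
    constructor
    · rintro ⟨⟨h₁, h₂⟩, h₃⟩
      rw [if_pos h₁] at h₃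
      subst h₃
      exact ⟨b, ⟨h₂, YoungDiagram.mem_iff_lt_rowLen.1 h₁⟩, rfl, rfl⟩
    · rintro ⟨b', ⟨h₁, h₂⟩, rfl, rfl⟩
      have := YoungDiagram.mem_iff_lt_rowLen.2 h₂
      exact ⟨⟨this, h₁⟩, by rw [if_pos this]⟩
  rw [entryCount, this, Finset.card_image_of_injective _ (fun _ _ h => (Prod.mk.inj h).2),
    Nat.card_Ico]

theorem entryCount_highestWeight (μ : YoungDiagram) (k : ℕ) :
    entryCount μ.cells (SemistandardYoungTableau.highestWeight μ) k = μ.rowLen k := by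
  simpa [rightCols_zero] using entryCount_rightCols_highestWeight μ 0 k

/-- The exponent vector of the leading term of the alternant belonging to `μ`. -/
def shiftedParts (μ : YoungDiagram) (N : ℕ) (i : Fin N) : ℕ := μ.rowLen i + staircase N i

theorem strictAnti_shiftedParts (μ : YoungDiagram) (N : ℕ) : StrictAnti (shiftedParts μ N) := by
  intro a b hab
  have := μ.rowLen_anti a b hab.le
  have : (a : ℕ) < b := hab
  simp only [shiftedParts, staircase]
  omega

/-- The bialternant formula: the filling by row indices is the only one that survives the
cancellation. -/
theorem alternant_mul_schurPoly_cells (μ : YoungDiagram) {N : ℕ}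
    (hN : ∀ k, 0 < μ.rowLen k → k < N) :
    alternant (staircase N) * schurPoly μ.cells N = alternant (shiftedParts μ N) := by
  classical
  let H : ℕ → ℕ → ℕ := SemistandardYoungTableau.highestWeight μ
  have hH : (tableaux μ.cells N).filter (IsYamanouchi μ.cells) = {H} := by
    ext T
    rw [Finset.mem_filter, Finset.mem_singleton, mem_tableaux]
    constructor
    · rintro ⟨⟨hT, h₀, -⟩, hY⟩
      funext i j
      simp only [H, SemistandardYoungTableau.highestWeight_apply]
      split_ifs with h
      · exact hY.eq_row hT h
      · exact h₀ i j h
    · rintro rfl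
      refine ⟨⟨⟨fun hj _ h => SemistandardYoungTableau.row_weak _ hj h,
        fun hi _ h => SemistandardYoungTableau.col_strict _ hi h⟩,
        fun i j h => SemistandardYoungTableau.zeros _ h, fun c hc => ?_⟩, fun j k => ?_⟩
      · simp only [H, SemistandardYoungTableau.highestWeight_apply]
        rw [YoungDiagram.mem_cells] at hc
        rw [if_pos hc]
        have := YoungDiagram.mem_iff_lt_rowLen.1 hc
        exact hN _ (by omega)
      · simp only [H, entryCount_rightCols_highestWeight]
        have := μ.rowLen_anti k (k + 1) (by omega)
        omega
  have hsum := alternant_mul_schurPoly (isSkew_cells μ) N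
  rw [hH, Finset.sum_singleton] at hsum
  rw [hsum]
  congr 1
  funext i
  simp only [Pi.add_apply, exponent, H, entryCount_highestWeight, shiftedParts]

/-! ### The Schur support and Yamanouchi fillings -/

theorem fillingContent_apply (C : Finset (ℕ × ℕ)) (T : ℕ → ℕ → ℕ) (k : ℕ) :
    fillingContent C T k = entryCount C T k := by
  simp [fillingContent, Finsupp.finsetSum_apply, Finsupp.single_apply, entryCount]

theorem coeff_schurPoly (C : Finset (ℕ × ℕ)) {N : ℕ} {t : ℕ →₀ ℕ} (ht : ∀ k, N ≤ k → t k = 0) :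
    MvPolynomial.coeff (Finsupp.equivFunOnFinite.symm fun i : Fin N => t i) (schurPoly C N) =
      Nat.card {T : ℕ → ℕ → ℕ // (IsSemistandard C T ∧ ∀ i j, (i, j) ∉ C → T i j = 0) ∧
        fillingContent C T = t} := by
  classical
  rw [schurPoly, MvPolynomial.coeff_sum]
  simp only [powProd_eq_monomial, MvPolynomial.coeff_monomial,
    Finsupp.equivFunOnFinite.symm.injective.eq_iff]
  rw [Finset.sum_boole]
  congr 1
  symm
  refine Nat.subtype_card _ fun T => ?_
  rw [Finset.mem_filter, mem_tableaux]
  constructor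
  · rintro ⟨⟨h₁, h₂, h₃⟩, h₄⟩
    refine ⟨⟨h₁, h₂⟩, ?_⟩
    ext k
    rw [fillingContent_apply]
    by_cases hk : k < N
    · exact congrFun h₄ ⟨k, hk⟩
    · rw [ht k (not_lt.1 hk), entryCount, Finset.card_eq_zero, Finset.filter_eq_empty_iff]
      intro c hc he
      exact hk (he ▸ h₃ c hc)
  · rintro ⟨⟨h₁, h₂⟩, rfl⟩
    refine ⟨⟨h₁, h₂, fun c hc => ?_⟩, ?_⟩
    · by_contra hlt
      have := ht _ (not_lt.1 hlt)
      rw [fillingContent_apply, entryCount, Finset.card_eq_zero, Finset.filter_eq_empty_iff] at this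
      exact this hc rfl
    · funext i
      rw [fillingContent_apply]; rfl

theorem coeff_skewSchurFunction (A : SkewShape) {N : ℕ} {t : ℕ →₀ ℕ} (ht : ∀ k, N ≤ k → t k = 0) :
    MvPowerSeries.coeff t (skewSchurFunction A) =
      MvPolynomial.coeff (Finsupp.equivFunOnFinite.symm fun i : Fin N => t i)
        (schurPoly A.cells N) := by
  rw [coeff_schurPoly A.cells ht]
  change ((Nat.card _ : ℕ) : ℚ) = _
  congr 1
  refine Nat.card_congr ⟨fun T => ⟨T.1.entry, ⟨⟨T.1.row_weak, T.1.col_strict⟩,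
    fun _ _ => T.1.zeros⟩, T.2⟩, fun T => ⟨⟨T.1, T.2.1.1.row, T.2.1.1.col, T.2.1.2 _ _⟩, T.2.2⟩,
    fun T => rfl, fun T => rfl⟩

theorem coeff_schurFunction (ν : YoungDiagram) {N : ℕ} {t : ℕ →₀ ℕ} (ht : ∀ k, N ≤ k → t k = 0) :
    MvPowerSeries.coeff t (schurFunction ν) =
      MvPolynomial.coeff (Finsupp.equivFunOnFinite.symm fun i : Fin N => t i)
        (schurPoly ν.cells N) := by
  rw [coeff_schurPoly ν.cells ht]
  change ((Nat.card _ : ℕ) : ℚ) = _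
  congr 1
  refine Nat.card_congr ⟨fun T => ⟨T.1, ⟨⟨fun hj _ h => T.1.row_weak hj h,
    fun hi _ h => T.1.col_strict hi h⟩, fun _ _ h => T.1.zeros h⟩, T.2⟩,
    fun T => ⟨⟨T.1, fun hj h => T.2.1.1.row hj (ν.up_left_mem le_rfl hj.le h) h,
      fun hi h => T.2.1.1.col hi (ν.up_left_mem hi.le le_rfl h) h, T.2.1.2 _ _⟩, T.2.2⟩,
    fun T => rfl, fun T => rfl⟩

theorem exists_youngDiagram {f : ℕ → ℕ} (hf : Antitone f) {M : ℕ} (hM : ∀ i, 0 < f i → i < M) :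
    ∃ μ : YoungDiagram, ∀ i, μ.rowLen i = f i := by
  have hmem : ∀ a b, (a, b) ∈ (Finset.range M ×ˢ Finset.range (f 0)).filter (fun c => c.2 < f c.1) ↔
      b < f a := by
    intro a b
    simp only [Finset.mem_filter, Finset.mem_product, Finset.mem_range]
    exact ⟨fun h => h.2, fun h => ⟨⟨hM a (by omega), h.trans_le (hf (Nat.zero_le a))⟩, h⟩⟩
  let μ : YoungDiagram := ⟨(Finset.range M ×ˢ Finset.range (f 0)).filter fun c => c.2 < f c.1, by
    rintro ⟨a, b⟩ ⟨a', b'⟩ hle h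
    rw [Finset.mem_coe, hmem] at h ⊢
    exact (lt_of_le_of_lt hle.2 h).trans_le (hf hle.1)⟩
  refine ⟨μ, fun i => eq_of_forall_lt_iff fun j => ?_⟩
  rw [← YoungDiagram.mem_iff_lt_rowLen]
  exact hmem i j

theorem YoungDiagram.ext_rowLen {μ ν : YoungDiagram} (h : ∀ i, μ.rowLen i = ν.rowLen i) : μ = ν := by
  refine YoungDiagram.ext (Finset.ext fun ⟨a, b⟩ => ?_)
  rw [YoungDiagram.mem_cells, YoungDiagram.mem_cells, YoungDiagram.mem_iff_lt_rowLen,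
    YoungDiagram.mem_iff_lt_rowLen, h]

theorem exists_shape {C : Finset (ℕ × ℕ)} {T : ℕ → ℕ → ℕ} (h : IsYamanouchi C T) :
    ∃ μ : YoungDiagram, ∀ i, μ.rowLen i = entryCount C T i :=
  exists_youngDiagram h.antitone_entryCount fun _ => h.lt_card

open Classical in
/-- The Littlewood–Richardson fillings of `C`. -/
noncomputable def yamanouchiTableaux (C : Finset (ℕ × ℕ)) : Finset (ℕ → ℕ → ℕ) :=
  (tableaux C C.card).filter (IsYamanouchi C)

theorem mem_yamanouchiTableaux {C : Finset (ℕ × ℕ)} {T : ℕ → ℕ → ℕ} :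
    T ∈ yamanouchiTableaux C ↔
      IsSemistandard C T ∧ (∀ i j, (i, j) ∉ C → T i j = 0) ∧ IsYamanouchi C T := by
  classical
  rw [yamanouchiTableaux, Finset.mem_filter, mem_tableaux]
  refine ⟨fun h => ⟨h.1.1, h.1.2.1, h.2⟩, fun h => ⟨⟨h.1, h.2.1, fun c hc => ?_⟩, h.2.2⟩⟩
  exact h.2.2.lt_card (Finset.card_pos.2 ⟨c, Finset.mem_filter.2 ⟨hc, rfl⟩⟩)

open Classical in
theorem filter_tableaux_isYamanouchi {C : Finset (ℕ × ℕ)} {N : ℕ} (hN : C.card ≤ N) :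
    (tableaux C N).filter (IsYamanouchi C) = yamanouchiTableaux C := by
  ext T
  rw [mem_yamanouchiTableaux, Finset.mem_filter, mem_tableaux]
  refine ⟨fun h => ⟨h.1.1, h.1.2.1, h.2⟩, fun h => ⟨⟨h.1, h.2.1, fun c hc => ?_⟩, h.2.2⟩⟩
  exact (h.2.2.lt_card (Finset.card_pos.2 ⟨c, Finset.mem_filter.2 ⟨hc, rfl⟩⟩)).trans_le hN

theorem alternant_mul_schurPoly_eq_shapes {C : Finset (ℕ × ℕ)} (hC : IsSkew C) {N : ℕ}
    (hN : C.card ≤ N) {shape : (ℕ → ℕ → ℕ) → YoungDiagram}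
    (hshape : ∀ T ∈ yamanouchiTableaux C, ∀ i, (shape T).rowLen i = entryCount C T i) :
    alternant (staircase N) * schurPoly C N =
      ∑ T ∈ yamanouchiTableaux C, alternant (shiftedParts (shape T) N) := by
  classical
  rw [alternant_mul_schurPoly hC, filter_tableaux_isYamanouchi hN]
  refine Finset.sum_congr rfl fun T hT => ?_
  congr 1
  funext i
  simp only [Pi.add_apply, exponent, shiftedParts, hshape T hT]

theorem schurPoly_eq_sum {C : Finset (ℕ × ℕ)} (hC : IsSkew C) {N : ℕ}
    (hN : C.card ≤ N) {shape : (ℕ → ℕ → ℕ) → YoungDiagram}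
    (hshape : ∀ T ∈ yamanouchiTableaux C, ∀ i, (shape T).rowLen i = entryCount C T i) :
    schurPoly C N = ∑ T ∈ yamanouchiTableaux C, schurPoly (shape T).cells N := by
  refine mul_left_cancel₀ (alternant_staircase_ne_zero N) ?_
  rw [alternant_mul_schurPoly_eq_shapes hC hN hshape, Finset.mul_sum]
  refine Finset.sum_congr rfl fun T hT => ?_
  rw [alternant_mul_schurPoly_cells]
  intro k hk
  rw [hshape T hT] at hk
  exact ((mem_yamanouchiTableaux.1 hT).2.2.lt_card hk).trans_le hN

theorem skewSchurFunction_eq_sum (A : SkewShape) {shape : (ℕ → ℕ → ℕ) → YoungDiagram}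
    (hshape : ∀ T ∈ yamanouchiTableaux A.cells, ∀ i,
      (shape T).rowLen i = entryCount A.cells T i) :
    skewSchurFunction A = ∑ T ∈ yamanouchiTableaux A.cells, schurFunction (shape T) := by
  ext t
  have ht : ∀ k, max A.cells.card (t.support.sup id + 1) ≤ k → t k = 0 := by
    intro k hk
    by_contra h
    have := Finset.le_sup (f := id) (Finsupp.mem_support_iff.2 h)
    simp only [id] at this
    omega
  rw [coeff_skewSchurFunction A ht, schurPoly_eq_sum A.isSkew_cells (le_max_left _ _) hshape,
    MvPolynomial.coeff_sum, map_sum]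
  exact Finset.sum_congr rfl fun T _ => (coeff_schurFunction (shape T) ht).symm

theorem schurPoly_eq_of_linearCombination {A : SkewShape} {c : YoungDiagram →₀ ℚ}
    (h : skewSchurFunction A = Finsupp.linearCombination ℚ schurFunction c) (N : ℕ) :
    schurPoly A.cells N = ∑ κ ∈ c.support, c κ • schurPoly κ.cells N := by
  ext m
  have ht : ∀ k, N ≤ k → (m.mapDomain (Fin.val : Fin N → ℕ)) k = 0 := fun k hk =>
    Finsupp.mapDomain_of_notMem_range _ _ (by rintro ⟨i, rfl⟩; omega)
  have hm : (Finsupp.equivFunOnFinite.symm fun i : Fin N => m.mapDomain (Fin.val : Fin N → ℕ) i) =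
      m := by
    ext i
    simp [Finsupp.mapDomain_apply Fin.val_injective]
  have hA := coeff_skewSchurFunction A ht
  rw [hm, h, Finsupp.linearCombination_apply, Finsupp.sum, map_sum] at hA
  rw [← hA, MvPolynomial.coeff_sum]
  refine Finset.sum_congr rfl fun κ _ => ?_
  rw [map_smul, MvPolynomial.coeff_smul, coeff_schurFunction κ ht, hm]

/-- After multiplication by the Vandermonde alternant, any Schur expansion and the sum over
Yamanouchi fillings are both sums of alternants; the coefficient of the leading monomial for `ν` is
compared. -/
theorem mem_schurSupport_iff (A : SkewShape) (ν : YoungDiagram) :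
    ν ∈ schurSupport A ↔ ∃ T, IsSemistandard A.cells T ∧ IsYamanouchi A.cells T ∧
      ∀ k, entryCount A.cells T k = ν.rowLen k := by
  classical
  choose! shape hshape using fun T (hT : IsYamanouchi A.cells T) => exists_shape hT
  have hshape' : ∀ T ∈ yamanouchiTableaux A.cells, ∀ i,
      (shape T).rowLen i = entryCount A.cells T i := fun T hT =>
    hshape T (mem_yamanouchiTableaux.1 hT).2.2
  constructor
  · rintro ⟨c, hc, hpos⟩
    by_contra hno
    have hne : ∀ T ∈ yamanouchiTableaux A.cells, shape T ≠ ν := by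
      rintro T hT rfl
      have hT' := mem_yamanouchiTableaux.1 hT
      exact hno ⟨T, hT'.1, hT'.2.2, fun k => (hshape' T hT k).symm⟩
    -- Enough variables for every Yamanouchi filling and for every shape in `c`, so that
    -- `shiftedParts` loses no rows.
    let N := max A.cells.card (c.support.sup fun κ => κ.colLen 0)
    have hN : ∀ κ ∈ c.support, ∀ k, 0 < κ.rowLen k → k < N := by
      intro κ hκ k hk
      have h₁ := YoungDiagram.mem_iff_lt_colLen.1 (YoungDiagram.mem_iff_lt_rowLen.2 hk)
      have h₂ := Finset.le_sup (f := fun κ : YoungDiagram => κ.colLen 0) hκ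
      exact h₁.trans_le (h₂.trans (le_max_right _ _))
    have e₁ := alternant_mul_schurPoly_eq_shapes (N := N) A.isSkew_cells (le_max_left _ _) hshape'
    have e₂ : alternant (staircase N) * schurPoly A.cells N =
        ∑ κ ∈ c.support, c κ • alternant (shiftedParts κ N) := by
      rw [schurPoly_eq_of_linearCombination hc, Finset.mul_sum]
      refine Finset.sum_congr rfl fun κ hκ => ?_
      rw [mul_smul_comm, alternant_mul_schurPoly_cells κ (hN κ hκ)]
    have inj : ∀ κ : YoungDiagram, (∀ k, 0 < κ.rowLen k → k < N) →
        shiftedParts κ N = shiftedParts ν N → κ = ν := by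
      intro κ hκ h
      refine YoungDiagram.ext_rowLen fun i => ?_
      by_cases hi : i < N
      · simpa [shiftedParts] using congrFun h ⟨i, hi⟩
      · have h₁ : ¬ 0 < κ.rowLen i := fun h => hi (hκ i h)
        have h₂ : ¬ 0 < ν.rowLen i := fun h => hi (hN ν (Finsupp.mem_support_iff.2 hpos.ne') i h)
        omega
    have e₃ := congrArg
      (MvPolynomial.coeff (Finsupp.equivFunOnFinite.symm (shiftedParts ν N))) (e₁.symm.trans e₂)
    simp only [MvPolynomial.coeff_sum, MvPolynomial.coeff_smul] at e₃
    rw [Finset.sum_eq_zero, Finset.sum_eq_single ν] at e₃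
    · rw [coeff_alternant (strictAnti_shiftedParts _ _) (strictAnti_shiftedParts _ _),
        if_pos rfl] at e₃
      simp at e₃
      exact hpos.ne e₃
    · intro κ hκ hκν
      rw [coeff_alternant (strictAnti_shiftedParts _ _) (strictAnti_shiftedParts _ _),
        if_neg fun h => hκν (inj κ (hN κ hκ) h), smul_zero]
    · intro h
      exact absurd (Finsupp.mem_support_iff.2 hpos.ne') h
    · intro T hT
      rw [coeff_alternant (strictAnti_shiftedParts _ _) (strictAnti_shiftedParts _ _), if_neg]
      refine fun h => hne T hT (inj _ (fun k hk => ?_) h)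
      rw [hshape' T hT] at hk
      exact ((mem_yamanouchiTableaux.1 hT).2.2.lt_card hk).trans_le (le_max_left _ _)
  · rintro ⟨T, hT, hY, hν⟩
    let T₀ : ℕ → ℕ → ℕ := fun i j => if (i, j) ∈ A.cells then T i j else 0
    have heq : ∀ c ∈ A.cells, T₀ c.1 c.2 = T c.1 c.2 := fun c hc => if_pos hc
    have hT₀ : T₀ ∈ yamanouchiTableaux A.cells := by
      refine mem_yamanouchiTableaux.2 ⟨⟨fun hj h₁ h₂ => ?_, fun hi h₁ h₂ => ?_⟩,
        fun i j h => if_neg h, fun j k => ?_⟩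
      · rw [heq _ h₁, heq _ h₂]; exact hT.row hj h₁ h₂
      · rw [heq _ h₁, heq _ h₂]; exact hT.col hi h₁ h₂
      · rw [entryCount_congr (C := rightCols A.cells j)
          fun c hc => heq c (Finset.filter_subset _ _ hc)]
        exact hY j k
    have hshapeT : shape T₀ = ν := by
      refine YoungDiagram.ext_rowLen fun i => ?_
      rw [hshape' T₀ hT₀, entryCount_congr heq, hν]
    refine ⟨∑ T ∈ yamanouchiTableaux A.cells, Finsupp.single (shape T) 1, ?_, ?_⟩
    · rw [skewSchurFunction_eq_sum A hshape', map_sum]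
      exact Finset.sum_congr rfl fun T _ => by simp
    · rw [Finsupp.finsetSum_apply]
      refine Finset.sum_pos' (fun T _ => ?_) ⟨T₀, hT₀, by simp [hshapeT]⟩
      rw [Finsupp.single_apply]
      split_ifs <;> simp

/-! ### Fillings of ribbons and chains of partitions -/

/-- A chain of partitions `N 0 = ∅, N 1, …, N l = ν` in which `N (i + 1) / N i` is a horizontal strip
of size `α i`, such that, if `o i`, some box of the strip number `i` lies in a higher row than some
box of the next strip. -/
structure IsStripChain (α : ℕ → ℕ) (o : ℕ → Prop) (l : ℕ) (ν : ℕ → ℕ) (N : ℕ → ℕ → ℕ) : Prop where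
  zero : ∀ r, N 0 r = 0
  mono : ∀ i < l, ∀ r, N i r ≤ N (i + 1) r
  strip : ∀ i < l, ∀ r, N (i + 1) (r + 1) ≤ N i r
  size : ∀ i ≤ l, ∑ r ∈ Finset.range i, N i r = ∑ q ∈ Finset.range i, α q
  last : ∀ r, N l r = ν r
  descent : ∀ i, i + 1 < l → o i →
    ∃ r r', r < r' ∧ N i r < N (i + 1) r ∧ N (i + 1) r' < N (i + 2) r'

/-- The rows `0, …, l - 1` of `C` are intervals of lengths `α i ≥ 2` starting in column `s i`, and
each row ends at the latest in the first column of the row above. -/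
structure HasRibbonRows (C : Finset (ℕ × ℕ)) (α s : ℕ → ℕ) (l : ℕ) : Prop where
  mem_iff : ∀ {i j}, (i, j) ∈ C ↔ i < l ∧ s i ≤ j ∧ j < s i + α i
  two_le : ∀ {i}, i < l → 2 ≤ α i
  next : ∀ {i}, i + 1 < l → s (i + 1) + α (i + 1) ≤ s i + 1

/-- Rows `i` and `i + 1` share a column. -/
def RowsOverlap (α s : ℕ → ℕ) (l i : ℕ) : Prop := i + 1 < l ∧ s (i + 1) + α (i + 1) = s i + 1

/-- The number of entries `k` in the rows above row `i`. -/
def topCount (C : Finset (ℕ × ℕ)) (T : ℕ → ℕ → ℕ) (i k : ℕ) : ℕ :=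
  (C.filter fun c => c.1 < i ∧ T c.1 c.2 = k).card

/-- The number of entries `k` in row `i`. -/
def rowCount (C : Finset (ℕ × ℕ)) (T : ℕ → ℕ → ℕ) (i k : ℕ) : ℕ :=
  (C.filter fun c => c.1 = i ∧ T c.1 c.2 = k).card

theorem topCount_zero (C : Finset (ℕ × ℕ)) (T : ℕ → ℕ → ℕ) (k : ℕ) : topCount C T 0 k = 0 := by
  simp [topCount]

theorem topCount_succ (C : Finset (ℕ × ℕ)) (T : ℕ → ℕ → ℕ) (i k : ℕ) :
    topCount C T (i + 1) k = topCount C T i k + rowCount C T i k := by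
  unfold topCount rowCount
  rw [← Finset.card_union_of_disjoint]
  · congr 1
    ext c
    simp only [Finset.mem_filter, Finset.mem_union, Nat.lt_succ_iff_lt_or_eq]
    tauto
  · rw [Finset.disjoint_left]
    intro c h₁ h₂
    simp only [Finset.mem_filter] at h₁ h₂
    omega

theorem rowCount_pos {C : Finset (ℕ × ℕ)} {T : ℕ → ℕ → ℕ} {i j : ℕ} (h : (i, j) ∈ C) :
    0 < rowCount C T i (T i j) :=
  Finset.card_pos.2 ⟨(i, j), Finset.mem_filter.2 ⟨h, rfl, rfl⟩⟩

namespace HasRibbonRows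

variable {C : Finset (ℕ × ℕ)} {α s : ℕ → ℕ} {l : ℕ}

theorem start_lt (h : HasRibbonRows C α s l) {i i' : ℕ} (hi : i < i') (hl : i' < l) :
    s i' < s i := by
  induction i', hi using Nat.le_induction with
  | base =>
    have := h.next hl
    have : 2 ≤ α (i + 1) := h.two_le hl
    show s (i + 1) < s i
    omega
  | succ n hn ih => have := h.next hl; have := h.two_le hl; have := ih (by omega); omega

theorem end_le (h : HasRibbonRows C α s l) {i i' : ℕ} (hi : i < i') (hl : i' < l) :
    s i' + α i' ≤ s i + 1 := by
  obtain ⟨m, rfl⟩ : ∃ m, i' = m + 1 := ⟨i' - 1, by omega⟩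
  have := h.next hl
  rcases (Nat.lt_succ_iff.1 hi).lt_or_eq with h' | rfl
  · have := h.start_lt h' (by omega); omega
  · exact this

theorem end_le_of_add_two_le (h : HasRibbonRows C α s l) {i i' : ℕ} (hi : i + 2 ≤ i')
    (hl : i' < l) : s i' + α i' ≤ s i := by
  obtain ⟨m, rfl⟩ : ∃ m, i' = m + 1 := ⟨i' - 1, by omega⟩
  have := h.next hl
  have := h.start_lt (show i < m by omega) (by omega)
  omega

theorem eq_succ_of_mem (h : HasRibbonRows C α s l) {i i' j : ℕ} (hi : i < i') (h₁ : (i, j) ∈ C)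
    (h₂ : (i', j) ∈ C) : i' = i + 1 ∧ j = s i ∧ RowsOverlap α s l i := by
  rw [h.mem_iff] at h₁ h₂
  have e : i' = i + 1 := by
    by_contra hne
    have := h.end_le_of_add_two_le (show i + 2 ≤ i' by omega) h₂.1
    omega
  subst e
  have := h.next h₂.1
  exact ⟨rfl, by omega, h₂.1, by omega⟩

theorem card_row (h : HasRibbonRows C α s l) {i : ℕ} (hi : i < l) :
    (C.filter fun c => c.1 = i).card = α i := by
  have : C.filter (fun c => c.1 = i) = (Finset.Ico (s i) (s i + α i)).image fun j => (i, j) := by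
    ext ⟨a, b⟩
    simp only [Finset.mem_filter, Finset.mem_image, Finset.mem_Ico, Prod.mk.injEq, h.mem_iff]
    constructor
    · rintro ⟨⟨h₁, h₂⟩, rfl⟩; exact ⟨b, h₂, rfl, rfl⟩
    · rintro ⟨b', h₁, rfl, rfl⟩; exact ⟨⟨hi, h₁⟩, rfl⟩
  rw [this, Finset.card_image_of_injective _ (fun _ _ h => (Prod.mk.inj h).2), Nat.card_Ico]
  omega

/-- The Yamanouchi condition is read at the leftmost `r + 1` of row `i`, in column `j`. The columns
from `j` on contain every `r + 1` of the rows up to `i`. Their letters `r` all lie above row `i`: to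
the right of `j` row `i` is too large, and a lower row can meet these columns only directly below an
`r + 1`. -/
theorem strip_topCount_of_pos (h : HasRibbonRows C α s l) {T : ℕ → ℕ → ℕ} (hT : IsSemistandard C T)
    (hY : IsYamanouchi C T) {i : ℕ} (r : ℕ) (hpos : 0 < rowCount C T i (r + 1)) :
    topCount C T (i + 1) (r + 1) ≤ topCount C T i r := by
  obtain ⟨c, hc⟩ := Finset.card_pos.1 hpos
  obtain ⟨⟨i', j⟩, hm, hmin⟩ := Finset.exists_min_image _ Prod.snd ⟨c, hc⟩
  simp only [Finset.mem_filter] at hm hmin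
  obtain ⟨hm, rfl, hv⟩ := hm
  have hm' := h.mem_iff.1 hm
  have h₁ : topCount C T (i' + 1) (r + 1) ≤ entryCount (rightCols C j) T (r + 1) := by
    refine Finset.card_le_card fun c hc => ?_
    simp only [rightCols, Finset.mem_filter] at hc ⊢
    refine ⟨⟨hc.1, ?_⟩, hc.2.2⟩
    rcases (Nat.lt_succ_iff.1 hc.2.1).lt_or_eq with hlt | he
    · have := h.end_le hlt hm'.1
      have := (h.mem_iff (i := c.1) (j := c.2)).1 hc.1
      omega
    · exact hmin c ⟨hc.1, he, hc.2.2⟩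
  have h₂ : entryCount (rightCols C j) T r ≤ topCount C T i' r := by
    refine Finset.card_le_card fun c hc => ?_
    simp only [rightCols, Finset.mem_filter] at hc ⊢
    refine ⟨hc.1.1, ?_, hc.2⟩
    obtain ⟨a, b⟩ := c
    obtain ⟨⟨hab, hb⟩, hr⟩ := hc
    simp only at hb hr ⊢
    by_contra hlt
    rcases (not_lt.1 hlt).lt_or_eq with hlt' | rfl
    · have := h.end_le hlt' (h.mem_iff.1 hab).1
      have := h.mem_iff.1 hab
      obtain rfl : b = j := by omega
      have := hT.col hlt' hm hab
      omega
    · rcases hb.lt_or_eq with hb | rfl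
      · have := hT.row hb hm hab
        omega
      · omega
  exact h₁.trans ((hY j r).trans h₂)

theorem strip_topCount (h : HasRibbonRows C α s l) {T : ℕ → ℕ → ℕ} (hT : IsSemistandard C T)
    (hY : IsYamanouchi C T) (i r : ℕ) : topCount C T (i + 1) (r + 1) ≤ topCount C T i r := by
  rcases Nat.eq_zero_or_pos (rowCount C T i (r + 1)) with h₀ | hpos
  · induction i with
    | zero => rw [topCount_succ, h₀, topCount_zero]; exact Nat.zero_le _
    | succ n ih =>
      rw [topCount_succ, h₀, add_zero]
      refine le_trans ?_ (topCount_succ C T n r ▸ Nat.le_add_right _ _)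
      rcases Nat.eq_zero_or_pos (rowCount C T n (r + 1)) with h₁ | hpos
      · exact ih h₁
      · exact h.strip_topCount_of_pos hT hY r hpos
  · exact h.strip_topCount_of_pos hT hY r hpos

theorem topCount_eq_zero (h : HasRibbonRows C α s l) {T : ℕ → ℕ → ℕ} (hT : IsSemistandard C T)
    (hY : IsYamanouchi C T) {i r : ℕ} (hi : i ≤ r) : topCount C T i r = 0 := by
  induction i generalizing r with
  | zero => exact topCount_zero C T r
  | succ n ih =>
    obtain ⟨m, rfl⟩ : ∃ m, r = m + 1 := ⟨r - 1, by omega⟩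
    have := h.strip_topCount hT hY n m
    have := ih (r := m) (by omega)
    omega

theorem sum_topCount (h : HasRibbonRows C α s l) {T : ℕ → ℕ → ℕ} (hT : IsSemistandard C T)
    (hY : IsYamanouchi C T) {i : ℕ} (hi : i ≤ l) :
    ∑ r ∈ Finset.range i, topCount C T i r = ∑ q ∈ Finset.range i, α q := by
  have h₁ : (C.filter fun c => c.1 < i).card = ∑ r ∈ Finset.range i, topCount C T i r := by
    rw [Finset.card_eq_sum_card_fiberwise (f := fun c => T c.1 c.2) (t := Finset.range i)]
    · simp only [Finset.filter_filter, topCount]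
    · intro c hc
      simp only [Finset.coe_filter, Set.mem_ofPred_eq] at hc
      simp only [Finset.coe_range, Set.mem_Iio]
      by_contra hlt
      have := h.topCount_eq_zero hT hY (not_lt.1 hlt)
      rw [topCount, Finset.card_eq_zero, Finset.filter_eq_empty_iff] at this
      exact this hc.1 ⟨hc.2, rfl⟩
  have h₂ : (C.filter fun c => c.1 < i).card = ∑ q ∈ Finset.range i, α q := by
    rw [Finset.card_eq_sum_card_fiberwise (f := fun c => c.1) (t := Finset.range i)]
    · refine Finset.sum_congr rfl fun q hq => ?_
      rw [← h.card_row ((Finset.mem_range.1 hq).trans_le hi), Finset.filter_filter]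
      congr 1
      refine Finset.filter_congr fun c _ => ?_
      have := Finset.mem_range.1 hq
      omega
    · intro c hc
      simp only [Finset.coe_filter, Set.mem_ofPred_eq] at hc
      simpa using hc.2
  rw [← h₁, h₂]

theorem topCount_eq_entryCount (h : HasRibbonRows C α s l) (T : ℕ → ℕ → ℕ) (r : ℕ) :
    topCount C T l r = entryCount C T r := by
  unfold topCount entryCount
  congr 1
  refine Finset.filter_congr fun c hc => ?_
  have := (h.mem_iff (i := c.1) (j := c.2)).1 hc
  tauto

theorem isStripChain_topCount (h : HasRibbonRows C α s l) {T : ℕ → ℕ → ℕ}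
    (hT : IsSemistandard C T) (hY : IsYamanouchi C T) {ν : ℕ → ℕ}
    (hν : ∀ k, entryCount C T k = ν k) :
    IsStripChain α (RowsOverlap α s l) l ν (topCount C T) where
  zero := topCount_zero C T
  mono i _ r := topCount_succ C T i r ▸ Nat.le_add_right _ _
  strip i _ r := h.strip_topCount hT hY i r
  size _ hi := h.sum_topCount hT hY hi
  last r := (h.topCount_eq_entryCount T r).trans (hν r)
  descent i hi ho := by
    have h₀ := h.two_le (show i < l by omega)
    have h₀' := h.two_le hi
    have h₁ : (i, s i) ∈ C := h.mem_iff.2 ⟨by omega, le_rfl, by omega⟩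
    have h₂ : (i + 1, s i) ∈ C := by
      have := ho.2
      exact h.mem_iff.2 ⟨hi, by omega, by omega⟩
    refine ⟨T i (s i), T (i + 1) (s i), hT.col (Nat.lt_add_one i) h₁ h₂, ?_, ?_⟩
    · rw [topCount_succ]; have := rowCount_pos (T := T) h₁; omega
    · rw [topCount_succ _ _ (i + 1)]; have := rowCount_pos (T := T) h₂; omega

end HasRibbonRows

/-! ### The filling belonging to a chain -/

/-- The letter number `c` in the weakly increasing word with `m r` letters `r`. -/
theorem exists_word (m : ℕ → ℕ) (R : ℕ) : ∃ w : ℕ → ℕ, ∀ c < ∑ r ∈ Finset.range R, m r, ∀ r,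
    w c = r ↔ ∑ q ∈ Finset.range r, m q ≤ c ∧ c < ∑ q ∈ Finset.range (r + 1), m q := by
  classical
  have hmono : Monotone fun r => ∑ q ∈ Finset.range r, m q := fun a b hab =>
    Finset.sum_le_sum_of_subset (Finset.range_mono hab)
  refine ⟨fun c => if h : ∃ r, c < ∑ q ∈ Finset.range (r + 1), m q then Nat.find h else 0,
    fun c hc r => ?_⟩
  have hex : ∃ r, c < ∑ q ∈ Finset.range (r + 1), m q :=
    ⟨R, hc.trans_le (hmono (Nat.le_succ R))⟩
  simp only [dif_pos hex, Nat.find_eq_iff, not_lt]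
  constructor
  · rintro ⟨h₁, h₂⟩
    refine ⟨?_, h₁⟩
    rcases r with _ | r
    · simp
    · exact h₂ r (Nat.lt_add_one r)
  · rintro ⟨h₁, h₂⟩
    exact ⟨h₂, fun n hn => (hmono (show n + 1 ≤ r from hn)).trans h₁⟩

namespace IsStripChain

variable {α : ℕ → ℕ} {o : ℕ → Prop} {l : ℕ} {ν : ℕ → ℕ} {N : ℕ → ℕ → ℕ}

/-- A horizontal strip adds at most one new row, so the sums over `range i` in `size` see every box
of `N i`. -/
theorem eq_zero (h : IsStripChain α o l ν N) {i r : ℕ} (hi : i ≤ l) (hr : i ≤ r) : N i r = 0 := by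
  induction i generalizing r with
  | zero => exact h.zero r
  | succ n ih =>
    obtain ⟨m, rfl⟩ : ∃ m, r = m + 1 := ⟨r - 1, by omega⟩
    have := h.strip n (by omega) m
    have := ih (r := m) (by omega) (by omega)
    omega

theorem sum_sub (h : IsStripChain α o l ν N) {i : ℕ} (hi : i < l) :
    ∑ r ∈ Finset.range (i + 1), (N (i + 1) r - N i r) = α i := by
  have h₁ := h.size (i + 1) hi
  have h₂ := h.size i hi.le
  have h₃ : ∑ r ∈ Finset.range (i + 1), (N (i + 1) r - N i r) + ∑ r ∈ Finset.range (i + 1), N i r =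
      ∑ r ∈ Finset.range (i + 1), N (i + 1) r := by
    rw [← Finset.sum_add_distrib]
    exact Finset.sum_congr rfl fun r _ => Nat.sub_add_cancel (h.mono i hi r)
  rw [Finset.sum_range_succ (N i), h.eq_zero hi.le le_rfl] at h₃
  rw [Finset.sum_range_succ α] at h₁
  omega

variable {C : Finset (ℕ × ℕ)} {s : ℕ → ℕ}

theorem exists_filling (h : IsStripChain α (RowsOverlap α s l) l ν N)
    (hC : HasRibbonRows C α s l) :
    ∃ T, IsSemistandard C T ∧ IsYamanouchi C T ∧ ∀ k, entryCount C T k = ν k := by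
  choose w hw using fun i => exists_word (fun r => N (i + 1) r - N i r) (i + 1)
  -- Row `i` is filled with the letters of strip `i` in increasing order; `P i r` is the position
  -- where the letters `r` begin.
  set P : ℕ → ℕ → ℕ := fun i r => ∑ q ∈ Finset.range r, (N (i + 1) q - N i q) with hP
  have hPmono : ∀ i, Monotone (P i) := fun i a b hab =>
    Finset.sum_le_sum_of_subset (Finset.range_mono hab)
  have hPsucc : ∀ i r, P i (r + 1) = P i r + (N (i + 1) r - N i r) := fun i r =>
    Finset.sum_range_succ _ _
  have hPtot : ∀ i < l, P i (i + 1) = α i := fun i hi => h.sum_sub hi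
  have hPle : ∀ i < l, ∀ r, P i r ≤ α i := by
    intro i hi r
    rcases le_total r (i + 1) with hr | hr
    · rw [← hPtot i hi]; exact hPmono i hr
    · rw [← hPtot i hi]
      induction r, hr using Nat.le_induction with
      | base => rfl
      | succ n hn ih =>
        rw [hPsucc, h.eq_zero hi hn]; omega
  have hw' : ∀ i < l, ∀ c < α i, ∀ r, w i c = r ↔ P i r ≤ c ∧ c < P i (r + 1) := by
    intro i hi c hc r
    exact hw i c (by rw [h.sum_sub hi]; exact hc) r
  let T : ℕ → ℕ → ℕ := fun i j => w i (j - s i)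
  have hrow : ∀ i r, rowCount C T i r = if i < l then N (i + 1) r - N i r else 0 := by
    intro i r
    by_cases hi : i < l
    · have : C.filter (fun c => c.1 = i ∧ T c.1 c.2 = r) =
          (Finset.Ico (P i r) (P i (r + 1))).image fun c => (i, s i + c) := by
        ext ⟨a, b⟩
        simp only [Finset.mem_filter, Finset.mem_image, Finset.mem_Ico, Prod.mk.injEq, hC.mem_iff]
        constructor
        · rintro ⟨⟨h₁, h₂, h₃⟩, rfl, h₄⟩
          refine ⟨b - s a, (hw' a hi _ (by omega) r).1 h₄, rfl, by omega⟩
        · rintro ⟨c, h₁, rfl, rfl⟩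
          have hc : c < α i := h₁.2.trans_le (hPle i hi _)
          refine ⟨⟨hi, by omega, by omega⟩, rfl, ?_⟩
          simp only [T, Nat.add_sub_cancel_left]
          exact (hw' i hi c hc r).2 h₁
      rw [rowCount, this, Finset.card_image_of_injective, Nat.card_Ico, if_pos hi, hPsucc]
      · omega
      · intro a b hab
        have := (Prod.mk.inj hab).2
        omega
    · rw [if_neg hi, rowCount, Finset.card_eq_zero, Finset.filter_eq_empty_iff]
      rintro ⟨a, b⟩ hc ⟨rfl, -⟩
      exact hi (hC.mem_iff.1 hc).1
  have htop : ∀ i ≤ l, ∀ r, topCount C T i r = N i r := by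
    intro i hi r
    induction i with
    | zero => rw [topCount_zero, h.zero]
    | succ n ih =>
      have := h.mono n (by omega) r
      rw [topCount_succ, ih (by omega), hrow, if_pos (by omega)]
      omega
  refine ⟨T, ⟨fun {i j₁ j₂} hj h₁ h₂ => ?_, fun {i₁ i₂ j} hi h₁ h₂ => ?_⟩, fun j k => ?_, fun k => ?_⟩
  · rw [hC.mem_iff] at h₁ h₂
    by_contra hlt
    have e₁ := (hw' i h₁.1 (j₁ - s i) (by omega) _).1 rfl
    have e₂ := (hw' i h₁.1 (j₂ - s i) (by omega) _).1 rfl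
    have : P i (T i j₂ + 1) ≤ P i (T i j₁) := hPmono i (not_le.1 hlt)
    simp only [T] at this
    omega
  -- The common column is the first of the upper row, holding the least letter of its strip, and the
  -- last of the lower row, holding the greatest letter of the next strip. The descent says that the
  -- former is smaller.
  · obtain ⟨rfl, rfl, ho⟩ := hC.eq_succ_of_mem hi h₁ h₂
    obtain ⟨r, r', hr, hm, hm'⟩ := h.descent i₁ ho.1 ho
    have h₃ := hC.two_le (show i₁ < l by have := ho.1; omega)
    have h₄ := hC.two_le ho.1
    have h₅ := ho.2
    rw [hC.mem_iff] at h₁ h₂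
    have e₁ := (hw' i₁ h₁.1 (s i₁ - s i₁) (by omega) _).1 rfl
    have e₂ := (hw' (i₁ + 1) h₂.1 (s i₁ - s (i₁ + 1)) (by omega) _).1 rfl
    have a₁ : w i₁ (s i₁ - s i₁) ≤ r := by
      by_contra hlt
      have : P i₁ (r + 1) ≤ P i₁ (w i₁ (s i₁ - s i₁)) := hPmono i₁ (not_le.1 hlt)
      rw [hPsucc] at this
      omega
    have a₂ : r' ≤ w (i₁ + 1) (s i₁ - s (i₁ + 1)) := by
      by_contra hlt
      have t₁ : P (i₁ + 1) (w (i₁ + 1) (s i₁ - s (i₁ + 1)) + 1) ≤ P (i₁ + 1) r' :=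
        hPmono _ (not_le.1 hlt)
      have t₂ := hPle (i₁ + 1) h₂.1 (r' + 1)
      rw [hPsucc] at t₂
      have t₃ : N (i₁ + 1) r' < N (i₁ + 1 + 1) r' := hm'
      omega
    simp only [T]
    omega
  -- Row `i` is the first that starts left of column `j`. The rows above it lie entirely in the
  -- columns from `j` on, the rows below it entirely to the left, so the strip condition at `i`
  -- bounds both counts.
  · have hex : ∃ i, i = l ∨ s i < j := ⟨l, Or.inl rfl⟩
    classical
    obtain ⟨i, hi, hmin⟩ : ∃ i, (i = l ∨ s i < j) ∧ ∀ i' < i, ¬ (i' = l ∨ s i' < j) :=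
      ⟨Nat.find hex, Nat.find_spec hex, fun i' => Nat.find_min hex⟩
    have hil : i ≤ l := by
      by_contra hlt
      exact hmin l (not_le.1 hlt) (Or.inl rfl)
    have hge : topCount C T i k ≤ entryCount (rightCols C j) T k := by
      refine Finset.card_le_card fun c hc => ?_
      simp only [rightCols, Finset.mem_filter] at hc ⊢
      have h₁ := hmin c.1 hc.2.1
      have h₂ := (hC.mem_iff (i := c.1) (j := c.2)).1 hc.1
      exact ⟨⟨hc.1, by omega⟩, hc.2.2⟩
    refine le_trans ?_ hge
    rcases hil.lt_or_eq with hil | rfl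
    · have hle : entryCount (rightCols C j) T (k + 1) ≤ topCount C T (i + 1) (k + 1) := by
        refine Finset.card_le_card fun c hc => ?_
        simp only [rightCols, Finset.mem_filter] at hc ⊢
        refine ⟨hc.1.1, ?_, hc.2⟩
        have h₂ := (hC.mem_iff (i := c.1) (j := c.2)).1 hc.1.1
        by_contra hlt
        have := hC.end_le (show i < c.1 by omega) h₂.1
        omega
      rw [htop i hil.le]
      rw [htop (i + 1) hil] at hle
      exact hle.trans (h.strip i hil k)
    · have hle : entryCount (rightCols C j) T (k + 1) ≤ entryCount C T (k + 1) :=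
        Finset.card_le_card (Finset.filter_subset_filter _ (Finset.filter_subset _ _))
      rw [← hC.topCount_eq_entryCount, htop i le_rfl] at hle
      rw [htop i le_rfl]
      rcases i with _ | n
      · rw [h.zero] at hle; omega
      · exact hle.trans ((h.strip n (by omega) k).trans (h.mono n (by omega) k))
  · rw [← hC.topCount_eq_entryCount, htop l le_rfl, h.last]

end IsStripChain

theorem mem_schurSupport_iff_exists_chain {A : SkewShape} {α s : ℕ → ℕ} {l : ℕ}
    (hA : HasRibbonRows A.cells α s l) (ν : YoungDiagram) :
    ν ∈ schurSupport A ↔ ∃ N, IsStripChain α (RowsOverlap α s l) l ν.rowLen N := by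
  rw [mem_schurSupport_iff]
  exact ⟨fun ⟨T, hT, hY, hν⟩ => ⟨_, hA.isStripChain_topCount hT hY hν⟩,
    fun ⟨_, hN⟩ => hN.exists_filling hA⟩

/-! ### The rows of a monotone ribbon -/

theorem SkewShape.mem_cells_iff (A : SkewShape) {i j : ℕ} :
    (i, j) ∈ A.cells ↔ A.inner.rowLen i ≤ j ∧ j < A.outer.rowLen i := by
  rw [SkewShape.cells, Finset.mem_sdiff, YoungDiagram.mem_cells, YoungDiagram.mem_cells,
    YoungDiagram.mem_iff_lt_rowLen, YoungDiagram.mem_iff_lt_rowLen, not_lt, and_comm]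

theorem SkewShape.rowLength_eq (A : SkewShape) (i : ℕ) :
    A.rowLength i = A.outer.rowLen i - A.inner.rowLen i := by
  have : A.cells.filter (fun c => c.1 = i) =
      (Finset.Ico (A.inner.rowLen i) (A.outer.rowLen i)).image fun j => (i, j) := by
    ext ⟨a, b⟩
    simp only [Finset.mem_filter, Finset.mem_image, Finset.mem_Ico, Prod.mk.injEq, A.mem_cells_iff]
    constructor
    · rintro ⟨h₁, rfl⟩; exact ⟨b, h₁, rfl, rfl⟩
    · rintro ⟨b', h₁, rfl, rfl⟩; exact ⟨h₁, rfl⟩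
  rw [SkewShape.rowLength, this,
    Finset.card_image_of_injective _ (fun _ _ h => (Prod.mk.inj h).2), Nat.card_Ico]

theorem YoungDiagram.rowLen_pos_iff (μ : YoungDiagram) (i : ℕ) :
    0 < μ.rowLen i ↔ i < μ.colLen 0 := by
  rw [← YoungDiagram.mem_iff_lt_rowLen, YoungDiagram.mem_iff_lt_colLen]

/-- If row `i + 1` reached past the first column of row `i`, the first two columns of row `i` would
contain a `2 × 2` block, since row `i` has at least two boxes. -/
theorem IsMonotoneRibbon.hasRibbonRows {α : YoungDiagram} {p : List ℕ} {A : SkewShape}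
    (h : IsMonotoneRibbon α p A) :
    HasRibbonRows A.cells α.rowLen A.inner.rowLen (α.colLen 0) where
  mem_iff {i j} := by
    have h₁ := A.rowLength_eq i
    rw [h.rowLength_eq] at h₁
    have h₂ := α.rowLen_pos_iff i
    rw [A.mem_cells_iff]
    omega
  two_le hi := h.two_le _ hi
  next {i} hi := by
    have h₁ := A.rowLength_eq i
    have h₂ := A.rowLength_eq (i + 1)
    have h₃ := h.two_le i (by omega)
    have h₄ := h.two_le (i + 1) hi
    have h₅ := A.inner.rowLen_anti i (i + 1) (by omega)
    have h₆ := h.isRibbon i (A.inner.rowLen i)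
    rw [h.rowLength_eq] at h₁ h₂
    simp only [A.mem_cells_iff] at h₆
    omega

/-- Rows of length at least two let a column meet at most two rows, so every two-box column is the
first column of an overlapping row; these columns are distinct. -/
theorem HasRibbonRows.overlap_eq {A : SkewShape} {α s : ℕ → ℕ} {l : ℕ}
    (h : HasRibbonRows A.cells α s l) (i : ℕ) [DecidablePred (RowsOverlap α s l)] :
    A.overlap i = ((Finset.range l).filter fun a => i ≤ a ∧ RowsOverlap α s l a).card := by
  have key : (A.cells.image Prod.snd).filter
      (fun j => (A.cells.filter fun c => i ≤ c.1 ∧ c.2 = j).card = 2) =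
      ((Finset.range l).filter fun a => i ≤ a ∧ RowsOverlap α s l a).image s := by
    ext j
    simp only [Finset.mem_filter, Finset.mem_image, Finset.mem_range]
    constructor
    · rintro ⟨-, hcard⟩
      obtain ⟨c, hc, d, hd, hne⟩ := Finset.one_lt_card.1 (show 1 < _ by rw [hcard]; omega)
      obtain ⟨a, x⟩ := c
      obtain ⟨b, y⟩ := d
      simp only [Finset.mem_filter] at hc hd
      obtain ⟨hc, hca, rfl⟩ := hc
      obtain ⟨hd, hdb, rfl⟩ := hd
      rcases lt_trichotomy a b with hab | rfl | hab
      · obtain ⟨-, e, ho⟩ := h.eq_succ_of_mem hab hc hd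
        exact ⟨a, ⟨(h.mem_iff.1 hc).1, hca, ho⟩, e.symm⟩
      · exact absurd rfl hne
      · obtain ⟨-, e, ho⟩ := h.eq_succ_of_mem hab hd hc
        exact ⟨b, ⟨(h.mem_iff.1 hd).1, hdb, ho⟩, e.symm⟩
    · rintro ⟨a, ⟨ha, hia, ho⟩, rfl⟩
      have t₁ := h.two_le ha
      have t₂ := h.two_le ho.1
      have t₃ := ho.2
      have m₁ : (a, s a) ∈ A.cells := h.mem_iff.2 ⟨ha, le_rfl, by omega⟩
      have m₂ : (a + 1, s a) ∈ A.cells := h.mem_iff.2 ⟨ho.1, by omega, by omega⟩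
      refine ⟨⟨_, m₁, rfl⟩, Finset.card_eq_two.2 ⟨(a, s a), (a + 1, s a), by simp, ?_⟩⟩
      ext ⟨b, y⟩
      simp only [Finset.mem_filter, Finset.mem_insert, Finset.mem_singleton, Prod.mk.injEq]
      constructor
      · rintro ⟨hb, -, rfl⟩
        rcases lt_trichotomy a b with hab | rfl | hab
        · exact Or.inr ⟨(h.eq_succ_of_mem hab m₁ hb).1, rfl⟩
        · exact Or.inl ⟨rfl, rfl⟩
        · have := (h.eq_succ_of_mem hab hb m₁).2.1
          have := h.start_lt hab ha
          omega
      · rintro (⟨rfl, rfl⟩ | ⟨rfl, rfl⟩)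
        · exact ⟨m₁, hia, rfl⟩
        · exact ⟨m₂, by omega, rfl⟩
  rw [SkewShape.overlap, key, Finset.card_image_of_injOn]
  intro a ha b hb hab
  simp only [Finset.coe_filter, Set.mem_ofPred_eq, Finset.mem_range] at ha hb
  rcases lt_trichotomy a b with hlt | rfl | hlt
  · have := h.start_lt hlt hb.1; omega
  · rfl
  · have := h.start_lt hlt ha.1; omega

theorem IsMonotoneRibbon.rowsOverlap_iff {α : YoungDiagram} {p : List ℕ} {A : SkewShape}
    (h : IsMonotoneRibbon α p A) (i : ℕ) :
    RowsOverlap α.rowLen A.inner.rowLen (α.colLen 0) i ↔ p.getD i 0 = p.getD (i + 1) 0 + 1 := by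
  classical
  rw [← h.overlap_eq, ← h.overlap_eq, h.hasRibbonRows.overlap_eq, h.hasRibbonRows.overlap_eq]
  set l := α.colLen 0
  set o := RowsOverlap α.rowLen A.inner.rowLen l
  by_cases ho : o i
  · have : (Finset.range l).filter (fun a => i ≤ a ∧ o a) =
        insert i ((Finset.range l).filter fun a => i + 1 ≤ a ∧ o a) := by
      ext a
      simp only [Finset.mem_filter, Finset.mem_insert, Finset.mem_range]
      constructor
      · rintro ⟨h₁, h₂, h₃⟩
        rcases h₂.lt_or_eq with h₂ | rfl
        · exact Or.inr ⟨h₁, h₂, h₃⟩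
        · exact Or.inl rfl
      · rintro (rfl | ⟨h₁, h₂, h₃⟩)
        · exact ⟨by have := ho.1; omega, le_rfl, ho⟩
        · exact ⟨h₁, by omega, h₃⟩
    rw [this, Finset.card_insert_of_notMem (by simp)]
    simp [ho]
  · have : (Finset.range l).filter (fun a => i ≤ a ∧ o a) =
        (Finset.range l).filter fun a => i + 1 ≤ a ∧ o a := by
      refine Finset.filter_congr fun a _ => ⟨fun ⟨h₁, h₂⟩ => ⟨?_, h₂⟩, fun ⟨h₁, h₂⟩ => ⟨by omega, h₂⟩⟩
      rcases h₁.lt_or_eq with h₁ | rfl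
      · exact h₁
      · exact absurd h₂ ho
    rw [this]
    simp [ho]

/-! ### Existence of strip chains -/

/-- `μ` is a partition of `α 0 + ⋯ + α (i - 1)` that dominates `(α 0, …, α (i - 1))`. -/
structure IsAbove (α : ℕ → ℕ) (i : ℕ) (μ : ℕ → ℕ) : Prop where
  anti : Antitone μ
  le : ∀ k ≤ i, ∑ q ∈ Finset.range k, α q ≤ ∑ r ∈ Finset.range k, μ r
  size : ∑ r ∈ Finset.range i, μ r = ∑ q ∈ Finset.range i, α q
  zero : ∀ r, i ≤ r → μ r = 0

/-- The sequence `x, y, z, w, 0, 0, …`. -/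
def fourRows (x y z w : ℕ) : ℕ → ℕ
  | 0 => x
  | 1 => y
  | 2 => z
  | 3 => w
  | _ + 4 => 0

theorem eq_fourRows {μ : ℕ → ℕ} (hμ : Antitone μ) (h : μ 4 = 0) :
    μ = fourRows (μ 0) (μ 1) (μ 2) (μ 3) := by
  funext r
  rcases r with _ | _ | _ | _ | r <;> try rfl
  exact Nat.le_zero.1 (h ▸ hμ (show 4 ≤ r + 4 by omega))

theorem antitone_fourRows {x y z w : ℕ} (h₁ : y ≤ x) (h₂ : z ≤ y) (h₃ : w ≤ z) :
    Antitone (fourRows x y z w) := by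
  refine antitone_nat_of_succ_le fun r => ?_
  rcases r with _ | _ | _ | _ | r <;> simp [fourRows, h₁, h₂, h₃]

theorem sum_fourRows (x y z w k : ℕ) :
    ∑ r ∈ Finset.range (k + 4), fourRows x y z w r = x + y + z + w := by
  induction k with
  | zero => simp [Finset.sum_range_succ, fourRows]
  | succ n ih => rw [show n + 1 + 4 = (n + 4) + 1 by ring, Finset.sum_range_succ, ih]; simp [fourRows]

theorem sum_range_mono (α : ℕ → ℕ) : Monotone fun k => ∑ q ∈ Finset.range k, α q :=
  fun _ _ hab => Finset.sum_le_sum_of_subset (Finset.range_mono hab)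

theorem isAbove_fourRows {α : ℕ → ℕ} {i x y z w : ℕ} (hi : 3 ≤ i) (hw : i = 3 → w = 0)
    (h₁ : y ≤ x) (h₂ : z ≤ y) (h₃ : w ≤ z) (a₁ : α 0 ≤ x) (a₂ : α 0 + α 1 ≤ x + y)
    (a₃ : α 0 + α 1 + α 2 ≤ x + y + z)
    (hs : x + y + z + w = ∑ q ∈ Finset.range i, α q) : IsAbove α i (fourRows x y z w) := by
  refine ⟨antitone_fourRows h₁ h₂ h₃, fun k hk => ?_, ?_, fun r hr => ?_⟩
  · rcases k with _ | _ | _ | _ | k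
    · simp
    · simpa [fourRows] using a₁
    · simpa [Finset.sum_range_succ, fourRows] using a₂
    · simpa [Finset.sum_range_succ, fourRows] using a₃
    · rw [sum_fourRows, hs]
      exact sum_range_mono α hk
  · rw [← hs]
    rcases hi.lt_or_eq with hi | rfl
    · obtain ⟨k, rfl⟩ : ∃ k, i = k + 4 := ⟨i - 4, by omega⟩
      exact sum_fourRows x y z w k
    · simp [Finset.sum_range_succ, fourRows, hw rfl]
  · rcases r with _ | _ | _ | _ | r <;> try omega
    · exact hw (by omega)
    · rfl

theorem IsAbove.bounds {α : ℕ → ℕ} {i : ℕ} {μ : ℕ → ℕ} (h : IsAbove α i μ) (hi : 3 ≤ i)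
    (h₄ : μ 4 = 0) : μ 1 ≤ μ 0 ∧ μ 2 ≤ μ 1 ∧ μ 3 ≤ μ 2 ∧ α 0 ≤ μ 0 ∧ α 0 + α 1 ≤ μ 0 + μ 1 ∧
      α 0 + α 1 + α 2 ≤ μ 0 + μ 1 + μ 2 ∧
      μ 0 + μ 1 + μ 2 + μ 3 = ∑ q ∈ Finset.range i, α q := by
  refine ⟨h.anti (by omega), h.anti (by omega), h.anti (by omega), ?_, ?_, ?_, ?_⟩
  · simpa using h.le 1 (by omega)
  · simpa [Finset.sum_range_succ] using h.le 2 (by omega)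
  · simpa [Finset.sum_range_succ] using h.le 3 (by omega)
  · rw [← h.size]
    rcases hi.lt_or_eq with hi | rfl
    · obtain ⟨k, rfl⟩ : ∃ k, i = k + 4 := ⟨i - 4, by omega⟩
      rw [eq_fourRows h.anti h₄, sum_fourRows]
      rfl
    · rw [h.zero 3 le_rfl]
      simp [Finset.sum_range_succ]

/-- A horizontal strip can be removed so that the rest is as high as possible in the dominance
order. -/
theorem IsAbove.exists_strip {α : ℕ → ℕ} (hα : Antitone α) {i : ℕ} {ν : ℕ → ℕ}
    (h : IsAbove α (i + 1) ν) :
    ∃ μ, IsAbove α i μ ∧ (∀ r, μ r ≤ ν r) ∧ ∀ r, ν (r + 1) ≤ μ r := by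
  set S : ℕ → ℕ := fun k => ∑ r ∈ Finset.range k, ν r with hS
  have hS1 : ∀ k, S (k + 1) = S k + ν k := fun k => Finset.sum_range_succ _ _
  have hA1 : ∀ k, ∑ q ∈ Finset.range (k + 1), α q = ∑ q ∈ Finset.range k, α q + α k :=
    fun k => Finset.sum_range_succ _ _
  have hS0 : S 0 = 0 := rfl
  have hm : ∀ k, α i ≤ S (k + 1) := by
    intro k
    have h₁ := h.le 1 (by omega)
    have h₂ : S 1 ≤ S (k + 1) := sum_range_mono ν (by omega)
    have h₃ := hα (Nat.zero_le i)
    simp only [Finset.sum_range_one] at h₁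
    have h₄ : S 1 = ν 0 := by simp [hS]
    omega
  have hstep : ∀ k, min (S k) (S (k + 1) - α i) + (min (S (k + 1)) (S (k + 2) - α i) -
      min (S k) (S (k + 1) - α i)) = min (S (k + 1)) (S (k + 2) - α i) := by
    intro k
    have := hS1 k
    have := hS1 (k + 1)
    have : S (k + 1 + 1) = S (k + 2) := rfl
    omega
  -- Removing a horizontal strip of size `α i` bounds the `k`-th partial sum of the rest by `S k`,
  -- as boxes are removed, and by `S (k + 1) - α i`, as row `r` keeps at least `ν (r + 1)` boxes.
  -- Here the minimum is attained for all `k` at once. Dominance survives because `α i ≤ α k` for `k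
  -- ≤ i`.
  let μ : ℕ → ℕ := fun k =>
    min (S (k + 1)) (S (k + 2) - α i) - min (S k) (S (k + 1) - α i)
  have hsum : ∀ k, ∑ r ∈ Finset.range k, μ r = min (S k) (S (k + 1) - α i) := by
    intro k
    induction k with
    | zero => simp [hS0]
    | succ n ih => rw [Finset.sum_range_succ, ih]; exact hstep n
  have hle : ∀ r, μ r ≤ ν r := by
    intro r
    have h₁ := hS1 r
    have h₂ := hS1 (r + 1)
    have h₃ := hm r
    have h₄ := h.anti (show r ≤ r + 1 by omega)
    show min (S (r + 1)) (S (r + 2) - α i) - min (S r) (S (r + 1) - α i) ≤ ν r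
    have : S (r + 1 + 1) = S (r + 2) := rfl
    omega
  have hge : ∀ r, ν (r + 1) ≤ μ r := by
    intro r
    have h₁ := hS1 r
    have h₂ := hS1 (r + 1)
    have h₃ := hm r
    have h₄ := h.anti (show r ≤ r + 1 by omega)
    show ν (r + 1) ≤ min (S (r + 1)) (S (r + 2) - α i) - min (S r) (S (r + 1) - α i)
    have : S (r + 1 + 1) = S (r + 2) := rfl
    omega
  have hlast : S (i + 1) = ∑ q ∈ Finset.range (i + 1), α q := h.size
  have hsize : ∑ r ∈ Finset.range i, μ r = ∑ q ∈ Finset.range i, α q := by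
    rw [hsum]
    have h₁ := h.le i (by omega)
    have h₂ := hA1 i
    have h₃ : ∑ r ∈ Finset.range i, ν r = S i := rfl
    omega
  refine ⟨μ, ⟨antitone_nat_of_succ_le fun r => (hle (r + 1)).trans (hge r), fun k hk => ?_,
    hsize, fun r hr => ?_⟩, hle, hge⟩
  · rw [hsum]
    have h₁ := h.le k (by omega)
    have h₂ := h.le (k + 1) (by omega)
    have h₃ := hA1 k
    have h₄ := hα hk
    exact le_min h₁ (by
      have : ∑ r ∈ Finset.range (k + 1), ν r = S (k + 1) := rfl
      omega)
  · rcases hr.lt_or_eq with hr | rfl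
    · have := hle r
      have := h.zero r hr
      omega
    · have h₁ := hsum (i + 1)
      rw [Finset.sum_range_succ, hsize] at h₁
      have h₂ := hA1 i
      have h₃ : S (i + 1 + 1) = S (i + 1) := by rw [hS1, h.zero (i + 1) le_rfl, add_zero]
      rw [h₃] at h₁
      omega

/-- The appended strip enters the descent condition only at index `i - 1 ≥ d`, where no descent is
required. -/
theorem IsStripChain.extend {α : ℕ → ℕ} {d i : ℕ} {μ ν : ℕ → ℕ} {N : ℕ → ℕ → ℕ}
    (h : IsStripChain α (· < d) i μ N) (hd : d < i) (hle : ∀ r, μ r ≤ ν r)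
    (hge : ∀ r, ν (r + 1) ≤ μ r) (hν : IsAbove α (i + 1) ν) :
    IsStripChain α (· < d) (i + 1) ν (Function.update N (i + 1) ν) := by
  have e : ∀ j ≤ i, Function.update N (i + 1) ν j = N j := fun j hj =>
    Function.update_of_ne (by omega) _ _
  have e' : Function.update N (i + 1) ν (i + 1) = ν := Function.update_self _ _ _
  refine ⟨fun r => ?_, fun j hj r => ?_, fun j hj r => ?_, fun j hj => ?_, fun r => ?_,
    fun j hj ho => ?_⟩
  · rw [e 0 (by omega), h.zero]
  · rcases (Nat.lt_succ_iff.1 hj).lt_or_eq with hj | rfl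
    · rw [e j hj.le, e (j + 1) hj]; exact h.mono j hj r
    · rw [e j le_rfl, e', h.last]; exact hle r
  · rcases (Nat.lt_succ_iff.1 hj).lt_or_eq with hj | rfl
    · rw [e j hj.le, e (j + 1) hj]; exact h.strip j hj r
    · rw [e j le_rfl, e', h.last]; exact hge r
  · rcases hj.lt_or_eq with hj | rfl
    · rw [e j (by omega)]; exact h.size j (by omega)
    · rw [e']; exact hν.size
  · rw [e']
  · rw [e j (by omega), e (j + 1) (by omega), e (j + 2) (by omega)]
    exact h.descent j (by omega) ho

/-! ### Explicit chains of three and four strips. -/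

theorem exists_chain_three {α : ℕ → ℕ} {p q x y z : ℕ} (h₀ : 0 < α 0) (hpq : p + q = α 0 + α 1)
    (hp : α 0 ≤ p) (hq : q ≤ α 0) (hpx : p ≤ x) (hyp : y ≤ p) (hqy : q ≤ y) (hzq : z ≤ q)
    (hs : x + y + z = α 0 + α 1 + α 2) (d₀ : 0 < q) (d₁ : (α 0 < p ∧ q < y) ∨ 0 < z) :
    ∃ N, IsStripChain α (· < 2) 3 (fourRows x y z 0) N := by
  let N : ℕ → ℕ → ℕ := fun i => match i with
    | 0 => fourRows 0 0 0 0
    | 1 => fourRows (α 0) 0 0 0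
    | 2 => fourRows p q 0 0
    | _ => fourRows x y z 0
  refine ⟨N, fun r => ?_, fun i hi r => ?_, fun i hi r => ?_, fun i hi => ?_, fun r => rfl,
    fun i hi ho => ?_⟩
  · rcases r with _ | _ | _ | _ | r <;> rfl
  · interval_cases i <;> rcases r with _ | _ | _ | _ | r <;> simp [N, fourRows] <;> omega
  · interval_cases i <;> rcases r with _ | _ | _ | _ | r <;> simp [N, fourRows] <;> omega
  · interval_cases i <;> simp [N, fourRows, Finset.sum_range_succ] <;> omega
  · interval_cases i
    · exact ⟨0, 1, by simp [N, fourRows]; omega⟩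
    · rcases d₁ with d₁ | d₁
      · exact ⟨0, 1, by simp [N, fourRows]; omega⟩
      · exact ⟨1, 2, by simp [N, fourRows]; omega⟩

/-- The partitions after two and three strips are `(p, q)` and `(u, v, t)`. Each alternative in `d₁`
and `d₂` names a pair of rows realising the descent. The alternatives `0 < t` and `0 < w` need no
more, since the interlacing inequalities then supply the box in the row above. -/
theorem exists_chain_four {α : ℕ → ℕ} {p q u v t x y z w : ℕ} (h₀ : 0 < α 0)
    (hpq : p + q = α 0 + α 1) (hp : α 0 ≤ p) (hq : q ≤ α 0)
    (hpu : p ≤ u) (hvp : v ≤ p) (hqv : q ≤ v) (htq : t ≤ q)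
    (hs : u + v + t = α 0 + α 1 + α 2)
    (hux : u ≤ x) (hyu : y ≤ u) (hvy : v ≤ y) (hzv : z ≤ v) (htz : t ≤ z) (hwt : w ≤ t)
    (hs' : x + y + z + w = α 0 + α 1 + α 2 + α 3)
    (d₀ : 0 < q) (d₁ : (α 0 < p ∧ q < v) ∨ 0 < t)
    (d₂ : (p < u ∧ v < y) ∨ (p < u ∧ t < z) ∨ (q < v ∧ t < z) ∨ 0 < w) :
    ∃ N, IsStripChain α (· < 3) 4 (fourRows x y z w) N := by
  let N : ℕ → ℕ → ℕ := fun i => match i with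
    | 0 => fourRows 0 0 0 0
    | 1 => fourRows (α 0) 0 0 0
    | 2 => fourRows p q 0 0
    | 3 => fourRows u v t 0
    | _ => fourRows x y z w
  refine ⟨N, fun r => ?_, fun i hi r => ?_, fun i hi r => ?_, fun i hi => ?_, fun r => rfl,
    fun i hi ho => ?_⟩
  · rcases r with _ | _ | _ | _ | r <;> rfl
  · interval_cases i <;> rcases r with _ | _ | _ | _ | r <;> simp [N, fourRows] <;> omega
  · interval_cases i <;> rcases r with _ | _ | _ | _ | r <;> simp [N, fourRows] <;> omega
  · interval_cases i <;> simp [N, fourRows, Finset.sum_range_succ] <;> omega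
  · interval_cases i
    · exact ⟨0, 1, by simp [N, fourRows]; omega⟩
    · rcases d₁ with d₁ | d₁
      · exact ⟨0, 1, by simp [N, fourRows]; omega⟩
      · exact ⟨1, 2, by simp [N, fourRows]; omega⟩
    · rcases d₂ with d₂ | d₂ | d₂ | d₂
      · exact ⟨0, 1, by simp [N, fourRows]; omega⟩
      · exact ⟨0, 2, by simp [N, fourRows]; omega⟩
      · exact ⟨1, 2, by simp [N, fourRows]; omega⟩
      · exact ⟨2, 3, by simp [N, fourRows]; omega⟩

/-! ### Removing the last strip while the descents remain possible. -/

theorem fourRows_le {x y z w x' y' z' w' : ℕ} (h₁ : x' ≤ x) (h₂ : y' ≤ y) (h₃ : z' ≤ z)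
    (h₄ : w' ≤ w) (r : ℕ) : fourRows x' y' z' w' r ≤ fourRows x y z w r := by
  rcases r with _ | _ | _ | _ | r <;> simp [fourRows, h₁, h₂, h₃, h₄]

theorem fourRows_succ_le {x y z w x' y' z' w' : ℕ} (h₁ : y ≤ x') (h₂ : z ≤ y') (h₃ : w ≤ z')
    (r : ℕ) : fourRows x y z w (r + 1) ≤ fourRows x' y' z' w' r := by
  rcases r with _ | _ | _ | _ | r <;> simp [fourRows, h₁, h₂, h₃]

/-- The condition on `μ` that makes a chain with two descents possible. -/
def AdmitsTwoDescents (α μ : ℕ → ℕ) : Prop := 1 ≤ μ 2 ∨ (μ 2 = 0 ∧ α 0 < μ 0 ∧ 2 ≤ μ 1)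

/-- The condition on `μ` that makes a chain with three descents possible. -/
def AdmitsThreeDescents (α μ : ℕ → ℕ) : Prop :=
  1 ≤ μ 3 ∨ (μ 3 = 0 ∧ 1 ≤ μ 2 ∧ 2 ≤ μ 1 ∧ α 0 + α 1 < μ 0 + μ 1 ∧ (μ 0 = α 0 → 2 ≤ μ 2)) ∨
    (μ 3 = 0 ∧ μ 2 = 0 ∧ α 0 + 2 ≤ μ 0 ∧ 3 ≤ μ 1)

/-- If `ν` has a fourth row, any strip removal leaves a third row, which is all that is needed.
Otherwise at most three rows remain and the new partition is chosen by hand. -/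
theorem exists_strip_two {α : ℕ → ℕ} (hα : Antitone α) {i : ℕ} (hi : 3 ≤ i) (h2 : 2 ≤ α i)
    {ν : ℕ → ℕ} (h : IsAbove α (i + 1) ν) (hg : AdmitsTwoDescents α ν) :
    ∃ μ, IsAbove α i μ ∧ AdmitsTwoDescents α μ ∧ (∀ r, μ r ≤ ν r) ∧ ∀ r, ν (r + 1) ≤ μ r := by
  rcases Nat.eq_zero_or_pos (ν 3) with h₃ | h₃
  · have h₄ : ν 4 = 0 := Nat.le_zero.1 (h₃ ▸ h.anti (show 3 ≤ 4 by omega))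
    obtain ⟨b₁, b₂, b₃, b₄, b₅, b₆, b₇⟩ := h.bounds (by omega) h₄
    have hν := eq_fourRows h.anti h₄
    rw [Finset.sum_range_succ] at b₇
    have c₀ := hα (show 0 ≤ 1 by omega)
    have c₁ := hα (show 1 ≤ 2 by omega)
    have c₂ := hα (show 2 ≤ i by omega)
    have c₃ : α 0 + α 1 + α 2 ≤ ∑ q ∈ Finset.range i, α q := by
      simpa [Finset.sum_range_succ] using sum_range_mono α hi
    rw [AdmitsTwoDescents] at hg
    generalize ν 0 = x, ν 1 = y, ν 2 = z, ν 3 = w at *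
    generalize hn : ∑ q ∈ Finset.range i, α q = n at *
    generalize hm : α i = m at *
    subst h₃
    rw [hν]
    obtain ⟨x', y', z', hx, hy, hz, e₁, e₂, g₁, g₂, hs, hg⟩ : ∃ x' y' z', x' ≤ x ∧ y' ≤ y ∧ z' ≤ z ∧
        y ≤ x' ∧ z ≤ y' ∧ α 0 ≤ x' ∧ α 0 + α 1 ≤ x' + y' ∧ x' + y' + z' = n ∧
        (1 ≤ z' ∨ (z' = 0 ∧ α 0 < x' ∧ 2 ≤ y')) := by
      rcases hg with hg | ⟨rfl, hg⟩
      -- The greedy partial sums, with the bounds lowered by one so that the third row keeps a box.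
      · refine ⟨min x (x + y - m - 1), min (x + y) (n - 1) - min x (x + y - m - 1),
          n - min (x + y) (n - 1), ?_⟩
        omega
      -- The least first row allowed by the strip condition and by the need to exceed `α 0`.
      · refine ⟨max (max y (α 0 + 1)) (n - y), n - max (max y (α 0 + 1)) (n - y), 0, ?_⟩
        omega
    refine ⟨fourRows x' y' z' 0, isAbove_fourRows hi (fun _ => rfl) ?_ ?_ (by omega) g₁ g₂ ?_ ?_, hg,
      fourRows_le hx hy hz le_rfl, fourRows_succ_le e₁ e₂ (by omega)⟩ <;> omega
  · obtain ⟨μ, h₁, h₂, h₄⟩ := h.exists_strip hα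
    exact ⟨μ, h₁, Or.inl (h₃.trans_le (h₄ 2)), h₂, h₄⟩

theorem exists_chain_two {α : ℕ → ℕ} (hα : Antitone α) {l : ℕ} (hl : ∀ i < l, 2 ≤ α i) {i : ℕ}
    (hi : 3 ≤ i) (hil : i ≤ l) {ν : ℕ → ℕ} (h : IsAbove α i ν) (hg : AdmitsTwoDescents α ν) :
    ∃ N, IsStripChain α (· < 2) i ν N := by
  induction i, hi using Nat.le_induction generalizing ν with
  | base =>
    have h₃ := h.zero 3 le_rfl
    have h₄ := h.zero 4 (by omega)
    obtain ⟨b₁, b₂, b₃, b₄, b₅, b₆, b₇⟩ := h.bounds (by omega) h₄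
    have hν := eq_fourRows h.anti h₄
    have c₀ := hα (show 0 ≤ 1 by omega)
    have c₁ := hα (show 1 ≤ 2 by omega)
    have c₂ := hl 2 (by omega)
    simp only [Finset.sum_range_succ, Finset.sum_range_zero, zero_add] at b₇
    rw [AdmitsTwoDescents] at hg
    rw [hν]
    generalize ν 0 = x, ν 1 = y, ν 2 = z, ν 3 = w at *
    subst h₃
    rcases hg with hg | ⟨rfl, hg⟩
    · refine exists_chain_three (p := max (max (α 0) y) (α 0 + α 1 - y))
        (q := α 0 + α 1 - max (max (α 0) y) (α 0 + α 1 - y)) ?_ ?_ ?_ ?_ ?_ ?_ ?_ ?_ ?_ ?_ ?_ <;> omega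
    · refine exists_chain_three (p := max (max (α 0 + 1) y) (α 0 + α 1 + 1 - y))
        (q := α 0 + α 1 - max (max (α 0 + 1) y) (α 0 + α 1 + 1 - y)) ?_ ?_ ?_ ?_ ?_ ?_ ?_ ?_ ?_ ?_ ?_ <;>
        omega
  | succ n hn ih =>
    obtain ⟨μ, h₁, h₂, h₃, h₄⟩ := exists_strip_two hα hn (hl n (by omega)) h hg
    obtain ⟨N, hN⟩ := ih (by omega) h₁ h₂
    exact ⟨_, hN.extend hn h₃ h₄ h⟩

/-- As for two descents: a fifth row of `ν` guarantees a fourth row afterwards. Otherwise the choice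
depends on the number of rows of `ν`. -/
theorem exists_strip_three {α : ℕ → ℕ} (hα : Antitone α) {i : ℕ} (hi : 4 ≤ i) (h2 : 2 ≤ α i)
    {ν : ℕ → ℕ} (h : IsAbove α (i + 1) ν) (hg : AdmitsThreeDescents α ν) :
    ∃ μ, IsAbove α i μ ∧ AdmitsThreeDescents α μ ∧ (∀ r, μ r ≤ ν r) ∧ ∀ r, ν (r + 1) ≤ μ r := by
  rcases Nat.eq_zero_or_pos (ν 4) with h₄ | h₄
  · obtain ⟨b₁, b₂, b₃, b₄, b₅, b₆, b₇⟩ := h.bounds (by omega) h₄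
    have hν := eq_fourRows h.anti h₄
    rw [Finset.sum_range_succ] at b₇
    have c₀ := hα (show 0 ≤ 1 by omega)
    have c₁ := hα (show 1 ≤ 2 by omega)
    have c₂ := hα (show 2 ≤ 3 by omega)
    have c₃ := hα (show 3 ≤ i by omega)
    have c₄ : α 0 + α 1 + α 2 + α 3 ≤ ∑ q ∈ Finset.range i, α q := by
      simpa [Finset.sum_range_succ] using sum_range_mono α hi
    rw [AdmitsThreeDescents] at hg
    generalize ν 0 = x, ν 1 = y, ν 2 = z, ν 3 = w at *
    generalize hn : ∑ q ∈ Finset.range i, α q = n at *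
    generalize hm : α i = m at *
    rw [hν]
    obtain ⟨x', y', z', w', hx, hy, hz, hw, e₁, e₂, e₃, g₀, g₁, g₂, g₃, hs, hg⟩ :
        ∃ x' y' z' w', x' ≤ x ∧ y' ≤ y ∧ z' ≤ z ∧ w' ≤ w ∧
        y ≤ x' ∧ z ≤ y' ∧ w ≤ z' ∧ w' ≤ z' ∧ α 0 ≤ x' ∧ α 0 + α 1 ≤ x' + y' ∧
        α 0 + α 1 + α 2 ≤ x' + y' + z' ∧ x' + y' + z' + w' = n ∧
        (1 ≤ w' ∨ (w' = 0 ∧ 1 ≤ z' ∧ 2 ≤ y' ∧ α 0 + α 1 < x' + y' ∧ (x' = α 0 → 2 ≤ z')) ∨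
          (w' = 0 ∧ z' = 0 ∧ α 0 + 2 ≤ x' ∧ 3 ≤ y')) := by
      rcases hg with hg | ⟨rfl, hg₁, hg₂, hg₃, hg₄⟩ | ⟨rfl, rfl, hg₁, hg₂⟩
      -- Greedy removal again, with one box retained in the fourth row.
      · refine ⟨min x (x + y - m - 1), min (x + y) (x + y + z - m - 1) - min x (x + y - m - 1),
          min (x + y + z) (n - 1) - min (x + y) (x + y + z - m - 1),
          n - min (x + y + z) (n - 1), ?_⟩
        refine ⟨?_, ?_, ?_, ?_, ?_, ?_, ?_, ?_, ?_, ?_, ?_, ?_, Or.inl ?_⟩ <;> omega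
      -- When `x = α 0` the first row cannot shrink, and two boxes must stay in the third row.
      -- Otherwise one box there is enough, and the strip is taken from as low as possible.
      · rcases Nat.eq_or_lt_of_le b₄ with hx | hx
        · have := hg₄ hx.symm
          refine ⟨x, y + z - m - max 2 (z - m), max 2 (z - m), 0, ?_⟩
          refine ⟨?_, ?_, ?_, ?_, ?_, ?_, ?_, ?_, ?_, ?_, ?_, ?_,
            Or.inr (Or.inl ⟨?_, ?_, ?_, ?_, ?_⟩)⟩ <;> omega
        · by_cases hz : m + 1 ≤ z
          · refine ⟨x, y, z - m, 0, ?_⟩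
            refine ⟨?_, ?_, ?_, ?_, ?_, ?_, ?_, ?_, ?_, ?_, ?_, ?_,
              Or.inr (Or.inl ⟨?_, ?_, ?_, ?_, ?_⟩)⟩ <;> omega
          · by_cases hy : max z 2 + m + 1 ≤ y + z
            · refine ⟨x, y + z - 1 - m, 1, 0, ?_⟩
              refine ⟨?_, ?_, ?_, ?_, ?_, ?_, ?_, ?_, ?_, ?_, ?_, ?_,
                Or.inr (Or.inl ⟨?_, ?_, ?_, ?_, ?_⟩)⟩ <;> omega
            · refine ⟨n - 1 - max z 2, max z 2, 1, 0, ?_⟩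
              refine ⟨?_, ?_, ?_, ?_, ?_, ?_, ?_, ?_, ?_, ?_, ?_, ?_,
                Or.inr (Or.inl ⟨?_, ?_, ?_, ?_, ?_⟩)⟩ <;> omega
      · refine ⟨max (max y (α 0 + 2)) (n - y), n - max (max y (α 0 + 2)) (n - y), 0, 0, ?_⟩
        refine ⟨?_, ?_, ?_, ?_, ?_, ?_, ?_, ?_, ?_, ?_, ?_, ?_,
          Or.inr (Or.inr ⟨?_, ?_, ?_, ?_⟩)⟩ <;> omega
    refine ⟨fourRows x' y' z' w', isAbove_fourRows (by omega) ?_ ?_ ?_ g₀ g₁ g₂ g₃ ?_, hg,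
      fourRows_le hx hy hz hw, fourRows_succ_le e₁ e₂ e₃⟩ <;> omega
  · obtain ⟨μ, h₁, h₂, h₃⟩ := h.exists_strip hα
    exact ⟨μ, h₁, Or.inl (h₄.trans_le (h₃ 3)), h₂, h₃⟩

theorem exists_chain_four_of_admits {α : ℕ → ℕ} {x y z w : ℕ} (c₀ : α 1 ≤ α 0) (c₁ : α 2 ≤ α 1)
    (c₂ : α 3 ≤ α 2) (c₃ : 2 ≤ α 3) (b₁ : y ≤ x) (b₂ : z ≤ y) (b₃ : w ≤ z) (b₄ : α 0 ≤ x)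
    (b₅ : α 0 + α 1 ≤ x + y) (b₆ : α 0 + α 1 + α 2 ≤ x + y + z)
    (b₇ : x + y + z + w = α 0 + α 1 + α 2 + α 3)
    (hg : 1 ≤ w ∨ (w = 0 ∧ 1 ≤ z ∧ 2 ≤ y ∧ α 0 + α 1 < x + y ∧ (x = α 0 → 2 ≤ z)) ∨
      (w = 0 ∧ z = 0 ∧ α 0 + 2 ≤ x ∧ 3 ≤ y)) :
    ∃ N, IsStripChain α (· < 3) 4 (fourRows x y z w) N := by
  generalize ha : α 0 = a at *
  generalize hb : α 1 = b at *
  generalize hc : α 2 = c at *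
  generalize hd : α 3 = d at *
  obtain ⟨p, q, u, v, t, h₁, h₂, h₃, h₄, h₅, h₆, h₇, h₈, h₉, h₁₀, h₁₁, h₁₂, h₁₃, h₁₄, h₁₅, h₁₆, h₁₇⟩ :
      ∃ p q u v t, p + q = a + b ∧ a ≤ p ∧ q ≤ a ∧ p ≤ u ∧ v ≤ p ∧ q ≤ v ∧ t ≤ q ∧
        u + v + t = a + b + c ∧ u ≤ x ∧ y ≤ u ∧ v ≤ y ∧ z ≤ v ∧ t ≤ z ∧ w ≤ t ∧ 0 < q ∧
        ((a < p ∧ q < v) ∨ 0 < t) ∧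
        ((p < u ∧ v < y) ∨ (p < u ∧ t < z) ∨ (q < v ∧ t < z) ∨ 0 < w) := by
    -- Steps from three rows back to two, with the least first row that the constraints allow.
    have two : ∀ u v t, v ≤ u → t ≤ v → u + v + t = a + b + c → a ≤ u → a + b ≤ u + v → 0 < t →
        ∃ p q, p + q = a + b ∧ a ≤ p ∧ q ≤ a ∧ p ≤ u ∧ v ≤ p ∧ q ≤ v ∧ t ≤ q := by
      intro u v t k₁ k₂ k₃ k₄ k₅ k₆
      refine ⟨max (max a v) (a + b - v), a + b - max (max a v) (a + b - v), ?_⟩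
      omega
    rcases hg with hw | ⟨rfl, hz, hy, hxy, hx⟩ | ⟨rfl, rfl, hx, hy⟩
    · obtain ⟨u, v, t, k₁, k₂, k₃, k₄, k₅, k₆, k₇, k₈, k₉, k₁₀, k₁₁⟩ : ∃ u v t, v ≤ u ∧ t ≤ v ∧
          u + v + t = a + b + c ∧ a ≤ u ∧ a + b ≤ u + v ∧ u ≤ x ∧ y ≤ u ∧ v ≤ y ∧ z ≤ v ∧ t ≤ z ∧
          w ≤ t := by
        refine ⟨min x (x + y - d), min (x + y) (x + y + z - d) - min x (x + y - d),
          a + b + c - min (x + y) (x + y + z - d), ?_⟩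
        refine ⟨?_, ?_, ?_, ?_, ?_, ?_, ?_, ?_, ?_, ?_, ?_⟩ <;> omega
      obtain ⟨p, q, j₁, j₂, j₃, j₄, j₅, j₆, j₇⟩ := two u v t k₁ k₂ k₃ k₄ k₅ (by omega)
      exact ⟨p, q, u, v, t, j₁, j₂, j₃, j₄, j₅, j₆, j₇, k₃, k₆, k₇, k₈, k₉, k₁₀, k₁₁, by omega,
        Or.inr (by omega), Or.inr (Or.inr (Or.inr hw))⟩
    -- For `x = a` the first row is full from the start, so the second and third descents must both
    -- use rows `1` and `2`; this is where `2 ≤ z` enters.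
    · rcases Nat.eq_or_lt_of_le b₄ with rfl | hax
      · have hz₂ := hx rfl
        refine ⟨a, b, a, b + min (c - 1) (y - b), c - min (c - 1) (y - b), ?_⟩
        refine ⟨?_, ?_, ?_, ?_, ?_, ?_, ?_, ?_, ?_, ?_, ?_, ?_, ?_, ?_, ?_, Or.inr ?_,
          Or.inr (Or.inr (Or.inl ?_))⟩ <;> omega
      · by_cases hzd : z ≤ d
        -- The last strip can take the whole third row: the second descent uses rows `0` and `1`,
        -- the third one rows `1` and `2`.
        · obtain ⟨u, v, k₁, k₂, k₃, k₄, k₅, k₆, k₇, k₈⟩ : ∃ u v, v ≤ u ∧ u + v = a + b + c ∧ a < u ∧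
              2 ≤ v ∧ u ≤ x ∧ y ≤ u ∧ v ≤ y ∧ z ≤ v :=
            ⟨max (max (a + 1) y) (a + b + c - y), a + b + c - max (max (a + 1) y) (a + b + c - y),
              by omega⟩
          refine ⟨max (max (a + 1) v) (a + b + 1 - v),
            a + b - max (max (a + 1) v) (a + b + 1 - v), u, v, 0, ?_⟩
          refine ⟨?_, ?_, ?_, ?_, ?_, ?_, ?_, ?_, ?_, ?_, ?_, ?_, ?_, ?_, ?_, Or.inl ?_,
            Or.inr (Or.inr (Or.inl ?_))⟩ <;> omega
        -- The last strip lies entirely in the third row. As `a + b < x + y`, the strip before it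
        -- has a box in one of the first two rows.
        · obtain ⟨p, q, j₁, j₂, j₃, j₄, j₅, j₆, j₇⟩ := two x y (z - d) b₁ (by omega) (by omega) b₄ b₅
            (by omega)
          exact ⟨p, q, x, y, z - d, by omega⟩
    -- Here `e`, `f`, `g` count the boxes that strips `1`, `2`, `3` put in the first row. Strips `1`
    -- and `2` must meet both rows and strip `3` the second row, so that all descents use rows `0`
    -- and `1`.
    · have hb' : ∃ e f g, e + f + g + a = x ∧ 1 ≤ e ∧ e + 1 ≤ b ∧ 1 ≤ f ∧ f + 1 ≤ c ∧ g + 1 ≤ d ∧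
          y ≤ a + e + f ∧ b + c ≤ a + e + e + f :=
        ⟨min (b - 1) (x - a - 1), min (c - 1) (x - a - min (b - 1) (x - a - 1)),
          x - a - min (b - 1) (x - a - 1) - min (c - 1) (x - a - min (b - 1) (x - a - 1)), by omega⟩
      obtain ⟨e, f, g, k⟩ := hb'
      refine ⟨a + e, b - e, a + e + f, b + c - e - f, 0, ?_⟩
      refine ⟨?_, ?_, ?_, ?_, ?_, ?_, ?_, ?_, ?_, ?_, ?_, ?_, ?_, ?_, ?_, Or.inl ?_, Or.inl ?_⟩ <;>
        omega
  subst ha hb hc hd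
  exact exists_chain_four (by omega) h₁ h₂ h₃ h₄ h₅ h₆ h₇ h₈ h₉ h₁₀ h₁₁ h₁₂ h₁₃ h₁₄ b₇ h₁₅ h₁₆ h₁₇

theorem exists_chain_three_descents {α : ℕ → ℕ} (hα : Antitone α) {l : ℕ} (hl : ∀ i < l, 2 ≤ α i)
    {i : ℕ} (hi : 4 ≤ i) (hil : i ≤ l) {ν : ℕ → ℕ} (h : IsAbove α i ν)
    (hg : AdmitsThreeDescents α ν) : ∃ N, IsStripChain α (· < 3) i ν N := by
  induction i, hi using Nat.le_induction generalizing ν with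
  | base =>
    have h₄ := h.zero 4 le_rfl
    obtain ⟨b₁, b₂, b₃, b₄, b₅, b₆, b₇⟩ := h.bounds (by omega) h₄
    simp only [Finset.sum_range_succ, Finset.sum_range_zero, zero_add] at b₇
    rw [eq_fourRows h.anti h₄]
    exact exists_chain_four_of_admits (hα (by omega)) (hα (by omega)) (hα (by omega))
      (hl 3 (by omega)) b₁ b₂ b₃ b₄ b₅ b₆ b₇ hg
  | succ n hn ih =>
    obtain ⟨μ, h₁, h₂, h₃, h₄⟩ := exists_strip_three hα hn (hl n (by omega)) h hg
    obtain ⟨N, hN⟩ := ih (by omega) h₁ h₂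
    exact ⟨_, hN.extend hn h₃ h₄ h⟩

/-! ### Necessary conditions for strip chains -/

namespace IsStripChain

variable {α : ℕ → ℕ} {o : ℕ → Prop} {d l : ℕ} {ν : ℕ → ℕ} {N : ℕ → ℕ → ℕ}

theorem le_last (h : IsStripChain α o l ν N) {i : ℕ} (hi : i ≤ l) (r : ℕ) : N i r ≤ ν r := by
  rw [← h.last]
  induction l, hi using Nat.le_induction generalizing ν with
  | base => rfl
  | succ n hn ih =>
    have h' : IsStripChain α o n (N n) N := ⟨h.zero, fun j hj => h.mono j (by omega),
      fun j hj => h.strip j (by omega), fun j hj => h.size j (by omega), fun _ => rfl,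
      fun j hj => h.descent j (by omega)⟩
    exact (ih h').trans (h.mono n (by omega) r)

theorem sum_le (h : IsStripChain α o l ν N) {k : ℕ} (hk : k ≤ l) :
    ∑ q ∈ Finset.range k, α q ≤ ∑ r ∈ Finset.range k, ν r := by
  rw [← h.size k hk]
  exact Finset.sum_le_sum fun r _ => h.le_last hk r

theorem isAbove (h : IsStripChain α o l ν N) (hν : Antitone ν) : IsAbove α l ν := by
  refine ⟨hν, fun k hk => h.sum_le hk, ?_, fun r hr => ?_⟩
  · rw [← h.size l le_rfl]; exact Finset.sum_congr rfl fun r _ => (h.last r).symm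
  · rw [← h.last]; exact h.eq_zero le_rfl hr

theorem one_zero (h : IsStripChain α o l ν N) (hl : 1 ≤ l) : N 1 0 = α 0 := by
  simpa using h.size 1 hl

/-- Each required descent puts a box of the next strip below the first row, so every one of them
costs the first row a box. -/
theorem first_row_add_le (h : IsStripChain α (· < d) l ν N) {i : ℕ} (hi : i + 1 ≤ l) :
    N (i + 1) 0 + min i d ≤ ∑ q ∈ Finset.range (i + 1), α q := by
  induction i with
  | zero => simp [h.one_zero hi]
  | succ n ih =>
    have ih := ih (by omega)
    have hsum := h.sum_sub (i := n + 1) (by omega)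
    have hm := h.mono (n + 1) (by omega) 0
    rw [Finset.sum_range_succ' (fun r => N (n + 1 + 1) r - N (n + 1) r)] at hsum
    rw [Finset.sum_range_succ]
    by_cases hn : n < d
    · obtain ⟨r, r', hr, -, hr'⟩ := h.descent n (by omega) hn
      obtain ⟨m, rfl⟩ : ∃ m, r' = m + 1 := ⟨r' - 1, by omega⟩
      have hmem : m ∈ Finset.range (n + 1) := by
        rw [Finset.mem_range]
        by_contra hlt
        have := h.eq_zero (i := n + 2) (r := m + 1) (by omega) (by omega)
        omega
      have := Finset.single_le_sum (f := fun r => N (n + 1 + 1) (r + 1) - N (n + 1) (r + 1))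
        (fun _ _ => Nat.zero_le _) hmem
      have e : N (n + 2) (m + 1) = N (n + 1 + 1) (m + 1) := rfl
      omega
    · omega

/-- The first strip already fills row `0`, so strip `1` lies below it and the second descent needs
row `2`. -/
theorem not_two_rows_of_two_descents (h : IsStripChain α (· < 2) l ν N) (hl : 3 ≤ l)
    (h₀ : ν 0 ≤ α 0) (h₂ : ∀ r, 2 ≤ r → ν r = 0) : False := by
  obtain ⟨r, r', hr, hm, hm'⟩ := h.descent 1 (by omega) (by norm_num)
  have h₁ := h.one_zero (by omega)
  have hr₀ : r ≠ 0 := by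
    rintro rfl
    have := h.le_last (i := 1 + 1) (by omega) 0
    omega
  have := h.le_last (i := 1 + 2) (by omega) r'
  have := h₂ r' (by omega)
  omega

/-- With two rows, the last two descents put boxes of both strips `1` and `2` into row `0`, which
has room for only one beyond `α 0`. -/
theorem not_two_rows_of_three_descents (h : IsStripChain α (· < 3) l ν N) (hl : 4 ≤ l)
    (h₀ : ν 0 ≤ α 0 + 1) (h₂ : ∀ r, 2 ≤ r → ν r = 0) : False := by
  obtain ⟨r, r', hr, hm, hm'⟩ := h.descent 1 (by omega) (by norm_num)
  obtain ⟨s, s', hs, hn, hn'⟩ := h.descent 2 (by omega) (by norm_num)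
  have h₁ := h.one_zero (by omega)
  have hr₀ : r = 0 := by
    by_contra hne
    have := h.le_last (i := 1 + 2) (by omega) r'
    have := h₂ r' (by omega)
    omega
  have hs₀ : s = 0 := by
    by_contra hne
    have := h.le_last (i := 2 + 2) (by omega) s'
    have := h₂ s' (by omega)
    omega
  subst hr₀ hs₀
  have := h.le_last (i := 2 + 1) (by omega) 0
  have e : N (1 + 1) 0 = N 2 0 := rfl
  omega

/-- The first two strips already fill rows `0` and `1`, so strip `2` starts in row `2` and the third
descent needs row `3`. -/
theorem not_three_rows_of_three_descents (h : IsStripChain α (· < 3) l ν N) (hl : 4 ≤ l)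
    (h₀ : ν 0 ≤ α 0) (h₁ : ν 1 ≤ α 1) (h₃ : ∀ r, 3 ≤ r → ν r = 0) : False := by
  obtain ⟨r, r', hr, hm, hm'⟩ := h.descent 2 (by omega) (by norm_num)
  have hs := h.size 2 (by omega)
  simp only [Finset.sum_range_succ, Finset.sum_range_zero, zero_add] at hs
  have e₀ := h.le_last (i := 2) (by omega) 0
  have e₁ := h.le_last (i := 2) (by omega) 1
  have hle := h.le_last (i := 2 + 1) (by omega) r
  have hr₂ : 2 ≤ r := by
    rcases r with _ | _ | r
    · omega
    · simp only [zero_add] at *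
      omega
    · omega
  have := h.le_last (i := 2 + 2) (by omega) r'
  have := h₃ r' (by omega)
  omega

end IsStripChain

/-! ### Dominance intervals -/

theorem YoungDiagram.sum_rowLen (μ : YoungDiagram) (k : ℕ) :
    ∑ i ∈ Finset.range k, μ.rowLen i = (μ.cells.filter fun c => c.1 < k).card := by
  rw [Finset.card_eq_sum_card_fiberwise (f := fun c => c.1) (t := Finset.range k)]
  · refine Finset.sum_congr rfl fun q hq => ?_
    rw [μ.rowLen_eq_card, YoungDiagram.row, Finset.filter_filter]
    congr 1
    refine Finset.filter_congr fun c _ => ?_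
    have := Finset.mem_range.1 hq
    omega
  · intro c hc
    simp only [Finset.coe_filter, Set.mem_ofPred_eq] at hc
    simpa using hc.2

theorem YoungDiagram.sum_rowLen_le (μ : YoungDiagram) (k : ℕ) :
    ∑ i ∈ Finset.range k, μ.rowLen i ≤ μ.card := by
  rw [μ.sum_rowLen]
  exact Finset.card_le_card (Finset.filter_subset _ _)

theorem YoungDiagram.sum_rowLen_of_le (μ : YoungDiagram) {k : ℕ} (hk : ∀ r, k ≤ r → μ.rowLen r = 0) :
    ∑ i ∈ Finset.range k, μ.rowLen i = μ.card := by
  rw [μ.sum_rowLen, Finset.filter_true_of_mem]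
  rintro ⟨a, b⟩ hc
  by_contra hlt
  have := YoungDiagram.mem_iff_lt_rowLen.1 ((YoungDiagram.mem_cells _).1 hc)
  have := hk a (not_lt.1 hlt)
  omega

theorem YoungDiagram.rowLen_eq_zero (μ : YoungDiagram) {r : ℕ} (hr : μ.colLen 0 ≤ r) :
    μ.rowLen r = 0 := by
  have := μ.rowLen_pos_iff r
  omega

theorem rowLen_twoPartPartition {a b : ℕ} (hab : b ≤ a) (i : ℕ) :
    (twoPartPartition a b).rowLen i = fourRows a b 0 0 i := by
  refine eq_of_forall_lt_iff fun j => ?_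
  rw [← YoungDiagram.mem_iff_lt_rowLen, twoPartPartition, YoungDiagram.mem_ofRowLens]
  rcases i with _ | _ | _ | _ | i <;> simp [fourRows, hab]

theorem card_twoPartPartition {a b : ℕ} (hab : b ≤ a) : (twoPartPartition a b).card = a + b := by
  rw [← YoungDiagram.sum_rowLen_of_le _ (k := 4)]
  · simp [rowLen_twoPartPartition hab, Finset.sum_range_succ, fourRows]
  · intro r hr
    obtain ⟨m, rfl⟩ : ∃ m, r = m + 4 := ⟨r - 4, by omega⟩
    rw [rowLen_twoPartPartition hab]; rfl

/-- The upper end has only two parts, so its partial sums from the second on equal the total; only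
the bound on the first row remains. -/
theorem mem_dominanceInterval_iff {α : YoungDiagram} {d : ℕ} (hd : 2 * d ≤ α.card)
    (ν : YoungDiagram) :
    ν ∈ dominanceInterval α (twoPartPartition (α.card - d) d) ↔
      IsAbove α.rowLen (α.colLen 0) ν.rowLen ∧ ν.rowLen 0 + d ≤ α.card := by
  have hab : d ≤ α.card - d := by omega
  have hα := α.sum_rowLen_of_le (k := α.colLen 0) fun r hr => α.rowLen_eq_zero hr
  constructor
  · rintro ⟨⟨hc, hle⟩, ⟨-, hle'⟩⟩
    have hs : ∑ r ∈ Finset.range (α.colLen 0), ν.rowLen r = ν.card :=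
      le_antisymm (ν.sum_rowLen_le _) (by rw [← hc, ← hα]; exact hle _)
    refine ⟨⟨ν.rowLen_anti, fun k _ => hle k, by rw [hs, hα, hc], fun r hr => ?_⟩, ?_⟩
    · have h₁ := ν.sum_rowLen_le (r + 1)
      have h₂ := sum_range_mono ν.rowLen hr
      rw [Finset.sum_range_succ] at h₁
      simp only at h₂
      omega
    · have := hle' 1
      simp only [Finset.sum_range_one, rowLen_twoPartPartition hab, fourRows] at this
      omega
  · rintro ⟨h, h₀⟩
    have hc : ν.card = α.card := by
      rw [← ν.sum_rowLen_of_le h.zero, h.size, hα]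
    have hcard := card_twoPartPartition hab
    refine ⟨⟨hc.symm, fun k => ?_⟩, ⟨by omega, fun k => ?_⟩⟩
    · rcases le_total k (α.colLen 0) with hk | hk
      · exact h.le k hk
      · refine (α.sum_rowLen_le k).trans ?_
        rw [← hα, ← h.size]
        exact sum_range_mono ν.rowLen hk
    · rcases k with _ | _ | k
      · simp
      · simp only [zero_add, Finset.sum_range_one, rowLen_twoPartPartition hab, fourRows]
        omega
      · refine (ν.sum_rowLen_le _).trans ?_
        refine le_trans ?_ (sum_range_mono _ (show 2 ≤ k + 1 + 1 by omega))
        simp only [Finset.sum_range_succ _ 1, Finset.sum_range_one, rowLen_twoPartPartition hab,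
          fourRows]
        omega

/-! ### The Schur support of the two families of ribbons -/

theorem IsStripChain.congr {α ν : ℕ → ℕ} {o o' : ℕ → Prop} {l : ℕ} {N : ℕ → ℕ → ℕ}
    (h : IsStripChain α o l ν N) (ho : ∀ i, o' i → o i) : IsStripChain α o' l ν N :=
  ⟨h.zero, h.mono, h.strip, h.size, h.last, fun i hi hi' => h.descent i hi (ho i hi')⟩

theorem IsMonotoneRibbon.mem_schurSupport_iff {α : YoungDiagram} {p : List ℕ} {A : SkewShape}
    (h : IsMonotoneRibbon α p A) {d : ℕ}
    (hp : ∀ i, p.getD i 0 = p.getD (i + 1) 0 + 1 ↔ i < d) (ν : YoungDiagram) :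
    ν ∈ schurSupport A ↔
      ∃ N, IsStripChain α.rowLen (· < d) (α.colLen 0) ν.rowLen N := by
  rw [mem_schurSupport_iff_exists_chain h.hasRibbonRows]
  exact exists_congr fun N =>
    ⟨fun hN => hN.congr fun i hi => (h.rowsOverlap_iff i).2 ((hp i).2 hi),
      fun hN => hN.congr fun i hi => (hp i).1 ((h.rowsOverlap_iff i).1 hi)⟩

theorem IsMonotoneRibbon.lt_colLen {α : YoungDiagram} {p : List ℕ} {A : SkewShape}
    (h : IsMonotoneRibbon α p A) {d : ℕ} (hp : p.getD d 0 = p.getD (d + 1) 0 + 1) :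
    d + 1 < α.colLen 0 :=
  ((h.rowsOverlap_iff d).2 hp).1

theorem sum_Ico_rowLen (α : YoungDiagram) {k : ℕ} (hk : k ≤ α.colLen 0) :
    ∑ i ∈ Finset.range k, α.rowLen i + ∑ q ∈ Finset.Ico k (α.colLen 0), α.rowLen q = α.card := by
  rw [Finset.sum_range_add_sum_Ico _ hk]
  exact α.sum_rowLen_of_le fun r hr => α.rowLen_eq_zero hr

theorem IsAbove.bounds_of_rowLen {α ν : YoungDiagram}
    (h : IsAbove α.rowLen (α.colLen 0) ν.rowLen) (hl : 3 ≤ α.colLen 0) (h₃ : ν.rowLen 3 = 0) :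
    ν.rowLen 1 ≤ ν.rowLen 0 ∧ ν.rowLen 2 ≤ ν.rowLen 1 ∧ α.rowLen 0 ≤ ν.rowLen 0 ∧
      α.rowLen 0 + α.rowLen 1 ≤ ν.rowLen 0 + ν.rowLen 1 ∧
      ν.rowLen 0 + ν.rowLen 1 + ν.rowLen 2 = α.card := by
  obtain ⟨b₁, b₂, b₃, b₄, b₅, b₆, b₇⟩ := h.bounds hl
    (Nat.le_zero.1 (h₃ ▸ ν.rowLen_anti 3 4 (by omega)))
  rw [α.sum_rowLen_of_le fun r hr => α.rowLen_eq_zero hr] at b₇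
  omega

theorem schurSupport_eq_of_two_overlaps {α : YoungDiagram} {A : SkewShape}
    (h : IsMonotoneRibbon α [2, 1] A) :
    schurSupport A = dominanceInterval α (twoPartPartition (α.card - 2) 2) ↔
      α.rowLen 0 < ∑ q ∈ Finset.Ico 1 (α.colLen 0), α.rowLen q := by
  have hp : ∀ i, [2, 1].getD i 0 = [2, 1].getD (i + 1) 0 + 1 ↔ i < 2 := by
    intro i
    rcases i with _ | _ | i <;> simp
  have hl : 3 ≤ α.colLen 0 := h.lt_colLen ((hp 1).2 (by omega))
  have t₀ := h.two_le 0 (by omega)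
  have t₁ := h.two_le 1 (by omega)
  have t₂ := h.two_le 2 (by omega)
  have a₁ := α.rowLen_anti 0 1 (by omega)
  have hs := sum_Ico_rowLen α (k := 1) (by omega)
  have hs₃ := sum_Ico_rowLen α (k := 3) hl
  simp only [Finset.sum_range_succ, Finset.sum_range_zero, zero_add] at hs hs₃
  have hsize := α.sum_rowLen_of_le (k := α.colLen 0) fun r hr => α.rowLen_eq_zero hr
  have hint := mem_dominanceInterval_iff (α := α) (d := 2) (by omega)
  constructor
  · intro heq
    by_contra hlt
    -- The failed inequality is what makes `(α₁, |α| - α₁)` a partition; it lies in the interval.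
    have hν := rowLen_twoPartPartition (a := α.rowLen 0) (b := α.card - α.rowLen 0) (by omega)
    have hmem : twoPartPartition (α.rowLen 0) (α.card - α.rowLen 0) ∈ schurSupport A := by
      rw [heq, hint, funext hν]
      exact ⟨isAbove_fourRows hl (fun _ => rfl) (by omega) (by omega) (by omega) (by omega)
          (by omega) (by omega) (by omega), by simp only [fourRows]; omega⟩
    obtain ⟨N, hN⟩ := (h.mem_schurSupport_iff hp _).1 hmem
    rw [funext hν] at hN
    refine hN.not_two_rows_of_two_descents hl le_rfl fun r hr => ?_
    rcases r with _ | _ | _ | _ | r <;> simp [fourRows] at hr ⊢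
  · intro hlt
    ext ν
    rw [h.mem_schurSupport_iff hp, hint]
    constructor
    · rintro ⟨N, hN⟩
      refine ⟨hN.isAbove ν.rowLen_anti, ?_⟩
      have := hN.first_row_add_le (i := α.colLen 0 - 1) (by omega)
      rw [Nat.sub_add_cancel (by omega), hsize, hN.last] at this
      omega
    · rintro ⟨ha, h₀⟩
      refine exists_chain_two α.rowLen_anti h.two_le hl le_rfl ha ?_
      rcases Nat.eq_zero_or_pos (ν.rowLen 2) with h₂ | h₂
      · obtain ⟨b₁, b₂, b₃, b₄, b₅⟩ := ha.bounds_of_rowLen hl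
          (Nat.le_zero.1 (h₂ ▸ ν.rowLen_anti 2 3 (by omega)))
        -- For two rows, `ν 0` is at least half of `|α|`, which exceeds `α 0`.
        exact Or.inr ⟨h₂, by omega, by omega⟩
      · exact Or.inl h₂

theorem schurSupport_eq_of_three_overlaps {α : YoungDiagram} {A : SkewShape}
    (h : IsMonotoneRibbon α [3, 2, 1] A) :
    schurSupport A = dominanceInterval α (twoPartPartition (α.card - 3) 3) ↔
      α.rowLen 0 + 2 < ∑ q ∈ Finset.Ico 1 (α.colLen 0), α.rowLen q ∧
        α.rowLen 1 < ∑ q ∈ Finset.Ico 2 (α.colLen 0), α.rowLen q := by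
  have hp : ∀ i, [3, 2, 1].getD i 0 = [3, 2, 1].getD (i + 1) 0 + 1 ↔ i < 3 := by
    intro i
    rcases i with _ | _ | _ | i <;> simp
  have hl : 4 ≤ α.colLen 0 := h.lt_colLen ((hp 2).2 (by omega))
  have t₀ := h.two_le 0 (by omega)
  have t₁ := h.two_le 1 (by omega)
  have t₂ := h.two_le 2 (by omega)
  have t₃ := h.two_le 3 (by omega)
  have a₁ := α.rowLen_anti 0 1 (by omega)
  have hs := sum_Ico_rowLen α (k := 1) (by omega)
  have hs₂ := sum_Ico_rowLen α (k := 2) (by omega)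
  have hs₄ := sum_Ico_rowLen α (k := 4) hl
  simp only [Finset.sum_range_succ, Finset.sum_range_zero, zero_add] at hs hs₂ hs₄
  have hsize := α.sum_rowLen_of_le (k := α.colLen 0) fun r hr => α.rowLen_eq_zero hr
  have hint := mem_dominanceInterval_iff (α := α) (d := 3) (by omega)
  constructor
  · intro heq
    constructor
    · by_contra hlt
      have hν := rowLen_twoPartPartition (a := α.rowLen 0 + 1) (b := α.card - α.rowLen 0 - 1)
        (by omega)
      have hmem : twoPartPartition (α.rowLen 0 + 1) (α.card - α.rowLen 0 - 1) ∈ schurSupport A := by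
        rw [heq, hint, funext hν]
        exact ⟨isAbove_fourRows (by omega) (fun _ => rfl) (by omega) (by omega) (by omega) (by omega)
          (by omega) (by omega) (by omega), by simp only [fourRows]; omega⟩
      obtain ⟨N, hN⟩ := (h.mem_schurSupport_iff hp _).1 hmem
      rw [funext hν] at hN
      refine hN.not_two_rows_of_three_descents hl le_rfl fun r hr => ?_
      rcases r with _ | _ | _ | _ | r <;> simp [fourRows] at hr ⊢
    · by_contra hlt
      obtain ⟨ν, hν⟩ := exists_youngDiagram (M := 3)
        (antitone_fourRows (x := α.rowLen 0) (y := α.rowLen 1)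
          (z := α.card - α.rowLen 0 - α.rowLen 1) (w := 0) a₁ (by omega) (by omega)) fun i hi => by
            rcases i with _ | _ | _ | _ | i <;> simp [fourRows] at hi ⊢
      have hmem : ν ∈ schurSupport A := by
        rw [heq, hint, funext hν]
        exact ⟨isAbove_fourRows (by omega) (fun _ => rfl) (by omega) (by omega) (by omega) (by omega)
          (by omega) (by omega) (by omega), by simp only [fourRows]; omega⟩
      obtain ⟨N, hN⟩ := (h.mem_schurSupport_iff hp _).1 hmem
      rw [funext hν] at hN
      refine hN.not_three_rows_of_three_descents hl le_rfl le_rfl fun r hr => ?_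
      rcases r with _ | _ | _ | _ | r <;> simp [fourRows] at hr ⊢
  · rintro ⟨hlt, hlt'⟩
    ext ν
    rw [h.mem_schurSupport_iff hp, hint]
    constructor
    · rintro ⟨N, hN⟩
      refine ⟨hN.isAbove ν.rowLen_anti, ?_⟩
      have := hN.first_row_add_le (i := α.colLen 0 - 1) (by omega)
      rw [Nat.sub_add_cancel (by omega), hsize, hN.last] at this
      omega
    · rintro ⟨ha, h₀⟩
      refine exists_chain_three_descents α.rowLen_anti h.two_le hl le_rfl ha ?_
      rcases Nat.eq_zero_or_pos (ν.rowLen 3) with h₃ | h₃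
      · obtain ⟨b₁, b₂, b₃, b₄, b₅⟩ := ha.bounds_of_rowLen (by omega) h₃
        rcases Nat.eq_zero_or_pos (ν.rowLen 2) with h₂ | h₂
        -- Half of `|α|` exceeds `α 0 + 1`, by the first inequality.
        · exact Or.inr (Or.inr ⟨h₃, h₂, by omega, by omega⟩)
        -- Equality of the sums of the first two rows would give `ν 1 ≤ α 1 < ν 2`. If `ν 0 = α 0`
        -- and `ν 2 = 1`, then `ν 1` would exceed `ν 0`, by the first inequality.
        · exact Or.inr (Or.inl ⟨h₃, h₂, by omega, by omega, fun _ => by omega⟩)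
      · exact Or.inl h₃

/-- In the code indices start at `0`: `α.rowLen 0 = α₁`, and `α.colLen 0 = ℓ(α)` is the number of
parts of `α`. -/
theorem corollary1p5 (α : YoungDiagram) (A : SkewShape) :
    (IsMonotoneRibbon α [2, 1] A →
      (schurSupport A = dominanceInterval α (twoPartPartition (α.card - 2) 2) ↔
        α.rowLen 0 < ∑ q ∈ Finset.Ico 1 (α.colLen 0), α.rowLen q)) ∧
    (IsMonotoneRibbon α [3, 2, 1] A →
      (schurSupport A = dominanceInterval α (twoPartPartition (α.card - 3) 3) ↔
        (α.rowLen 0 : ℤ) < (∑ q ∈ Finset.Ico 1 (α.colLen 0), (α.rowLen q : ℤ)) - 2 ∧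
          α.rowLen 1 < ∑ q ∈ Finset.Ico 2 (α.colLen 0), α.rowLen q)) := by
  refine ⟨schurSupport_eq_of_two_overlaps, fun h => ?_⟩
  rw [schurSupport_eq_of_three_overlaps h, ← Nat.cast_sum]
  exact and_congr_left fun _ => by omega
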